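/- Let $0<\alpha<1$, $0<\beta<1$, $d\ge 1$, and let $D\subset\mathbb R^d$ be a bounded domain (nonempty, open, connected) with $\partial D\in C^{1,\alpha}$. Let $\Delta_D$ be the Dirichlet Laplacian on $L^2(D)$, i.e. the self-adjoint operator associated with the form $\int_D\nabla v\cdot\nabla w\,dx$ on $H^1_0(D)$, and let $(\phi_n)_{n\ge1}$ be a complete orthonormal basis of $L^2(D)$ consisting of eigenfunctions, $\Delta_D\phi_n=-\lambda_n\phi_n$, each taken in its version that is continuous on $\bar D$ with $\phi_n|_{\partial D}=0$. Let $f\in \mathrm{Dom}(\Delta_D)\cap C^1(\bar D)\cap C^2(D)$ be such that the eigenfunction expansion $\sum_n\bigl(\int_D\Delta f\,\phi_n\,dy\bigr)\phi_n(x)$ of $\Delta f$ converges to $\Delta f$ absolutely and uniformly on $D$. (Here $v\in C^1(\bar D)$ means that $v\in C^1(D)$ and that $v$ and its first derivatives are uniformly continuous on $D$.) Let $u:[0,\infty)\times\bar D\to\mathbb R$ be the classical solution of $$\partial_t^\beta u=\Delta u\ \text{ on }(0,\infty)\times D,\qquad u(t,x)=0\ \ (t>0,\ x\in\partial D),\qquad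 u(0,x)=f(x)\ \ (x\in D),$$ where $\partial_t^\beta u(t,x)=\frac1{\Gamma(1-\beta)}\int_0^t\frac{\partial_s u(s,x)}{(t-s)^{\beta}}\,ds$ is the Caputo derivative. That is, $u$ satisfies these equations and: $u$ is continuous and bounded on $[0,\infty)\times\bar D$; for each $t>0$, $u(t,\cdot)\in C^2(D)\cap C^1(\bar D)$; $\partial_tu$ exists on $(0,\infty)\times D$; $\partial_tu$, $\partial_t^\beta u$ and $\Delta u$ are continuous on $(0,\infty)\times D$; and $|\partial_tu(t,x)|\le g(x)t^{\beta-1}$ for $t>0$, $x\in D$, for some $g\in L^\infty(D)$. Let $x\in\bar D$, let $X$ be a Brownian motion in $\mathbb R^d$ started at $x$ with generator $\Delta$ (i.e. $X_t-X_s$ has covariance $2(t-s)I$), and let $S$ be a stable subordinator of index $\beta$, $\mathbb E[e^{-\theta S_t}]=e^{-t\theta^\beta}$ for $\theta>0$, independent of $X$. Put $E_t=\inf\{r>0:S_r>t\}$, and for a process $Y$ let $\tau_D(Y)=\inf\{t\ge0:Y_t\notin D\}$. Then for every $t\ge0$ the random variables below are integrable and $$u(t,x)=\mathbb E_x\bigl[f(X(E_t))\,I(\tau_D(X)>E_t)\bigr]=\mathbb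 E_x\bigl[f(X(E_t))\,I(\tau_D(X\circ E)>t)\bigr].$$ Moreover, for every path $Y:[0,\infty)\to\mathbb R^d$ that is continuous and every $e:[0,\infty)\to[0,\infty)$ that is continuous and nondecreasing with $e_0=0$, one has, for every $t\ge 0$, $\tau_D(Y\circ e)>t$ if and only if $\tau_D(Y)>e_t$. -/

import Mathlib

open MeasureTheory ProbabilityTheory Filter Topology Set
open scoped NNReal

noncomputable section

namespace FracCauchy

/-- `ℝ^d` with its Euclidean norm. -/
abbrev Rd (d : ℕ) : Type := EuclideanSpace ℝ (Fin d)

/-! ### Function spaces and domains -/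

/-- `g` is of class `C^{1,α}` on `U`: continuously differentiable, with a derivative that is
uniformly Hölder continuous of exponent `α` on `U`. -/
def IsC1Holder {d : ℕ} (α : ℝ≥0) (g : Rd d → Rd d) (U : Set (Rd d)) : Prop :=
  ContDiffOn ℝ 1 g U ∧ ∃ C : ℝ≥0, HolderOnWith C α (fderiv ℝ g) U

/-- `∂D ∈ C^{1,α}`: near each boundary point, a `C^{1,α}` diffeomorphism with `C^{1,α}` inverse
maps `D` onto an open half space and `∂D` onto its boundary hyperplane. -/
def HasC1HolderBoundary {d : ℕ} (α : ℝ≥0) (D : Set (Rd d)) : Prop :=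
  ∀ x₀ ∈ frontier D, ∃ (ψ : OpenPartialHomeomorph (Rd d) (Rd d)) (i : Fin d),
    x₀ ∈ ψ.source ∧
    IsC1Holder α ψ ψ.source ∧ IsC1Holder α ψ.symm ψ.target ∧
    (∀ y ∈ ψ.source, y ∈ D ↔ 0 < ψ y i) ∧
    (∀ y ∈ ψ.source, y ∈ frontier D ↔ ψ y i = 0)

/-- `v ∈ C¹(D̄)`: `v` is continuously differentiable on `D`, and `v` and its first derivatives are
uniformly continuous on `D`. -/
def IsC1Closure {d : ℕ} (D : Set (Rd d)) (v : Rd d → ℝ) : Prop :=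
  ContDiffOn ℝ 1 v D ∧ UniformContinuousOn v D ∧ UniformContinuousOn (fderiv ℝ v) D

/-! ### The Dirichlet Laplacian -/

/-- `η ∈ C_c^∞(D)`. -/
def IsTestFunction {d : ℕ} (D : Set (Rd d)) (η : Rd d → ℝ) : Prop :=
  ContDiff ℝ ((⊤ : ℕ∞) : WithTop ℕ∞) η ∧ HasCompactSupport η ∧ tsupport η ⊆ D

/-- `v ∈ H_0^1(D)` with weak gradient `G`: the pair `(v, G)` is a limit in `L²(D)` of pairs
`(η_k, ∇η_k)` with `η_k ∈ C_c^∞(D)`. -/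
def HasH10Gradient {d : ℕ} (D : Set (Rd d)) (v : Rd d → ℝ) (G : Rd d → Rd d) : Prop :=
  MemLp v 2 (volume.restrict D) ∧ MemLp G 2 (volume.restrict D) ∧
  ∃ η : ℕ → Rd d → ℝ, (∀ k, IsTestFunction D (η k)) ∧
    Tendsto (fun k => eLpNorm (fun x => η k x - v x) 2 (volume.restrict D)) atTop (𝓝 0) ∧
    Tendsto (fun k => eLpNorm (fun x => gradient (η k) x - G x) 2 (volume.restrict D))
      atTop (𝓝 0)

/-- `v ∈ D(Δ_D)` and `Δ_D v = h`, where `Δ_D` is the self-adjoint operator on `L²(D)` associated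
with the closed form `Q(v, w) = ∫_D ∇v · ∇w` with domain `H_0^1(D)`. -/
def HasDirichletLaplacian {d : ℕ} (D : Set (Rd d)) (v h : Rd d → ℝ) : Prop :=
  MemLp h 2 (volume.restrict D) ∧
  ∃ G, HasH10Gradient D v G ∧
    ∀ w W, HasH10Gradient D w W → ∫ x in D, inner ℝ (G x) (W x) = -∫ x in D, h x * w x

/-- `(φ_n)` is a complete orthonormal system of `L²(D)` of eigenfunctions of `Δ_D` with
eigenvalues `-lam n`, each represented by its version that is continuous on `D̄` and vanishes
on `∂D`. -/
structure IsDirichletEigenbasis {d : ℕ} (D : Set (Rd d)) (lam : ℕ → ℝ) (φ : ℕ → Rd d → ℝ) :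
    Prop where
  continuousOn : ∀ n, ContinuousOn (φ n) (closure D)
  boundary : ∀ n, ∀ x ∈ frontier D, φ n x = 0
  eigen : ∀ n, HasDirichletLaplacian D (φ n) (fun x => -lam n * φ n x)
  orthonormal : ∀ m n, ∫ x in D, φ m x * φ n x = if m = n then 1 else 0
  complete : ∀ g : Rd d → ℝ, MemLp g 2 (volume.restrict D) →
    (∀ n, ∫ x in D, g x * φ n x = 0) → g =ᵐ[volume.restrict D] 0

/-- The expansion `∑ (∫_D h φ_n) φ_n` of `h` converges to `h` absolutely and uniformly on `D`. -/
def ExpansionConverges {d : ℕ} (D : Set (Rd d)) (φ : ℕ → Rd d → ℝ) (h : Rd d → ℝ) : Prop :=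
  (∀ x ∈ D, Summable fun n => |(∫ y in D, h y * φ n y) * φ n x|) ∧
  TendstoUniformlyOn (fun N x => ∑ n ∈ Finset.range N, (∫ y in D, h y * φ n y) * φ n x) h atTop D

/-! ### The fractional Cauchy problem -/

/-- Caputo derivative of order `β`. -/
def caputo (β : ℝ) (h : ℝ → ℝ) (t : ℝ) : ℝ :=
  (Real.Gamma (1 - β))⁻¹ * ∫ s in (0 : ℝ)..t, deriv h s / (t - s) ^ β

/-- `u` is a classical solution on `[0, ∞) × D̄` of `∂_t^β u = Δ u` in `(0, ∞) × D`, `u = 0` on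
`(0, ∞) × ∂D`, `u(0, ·) = f` on `D`, in the class
`ℋ_Δ((0, ∞) × D) ∩ C_b([0, ∞) × D̄) ∩ C¹(D̄)`. -/
structure IsClassicalSolution {d : ℕ} (D : Set (Rd d)) (β : ℝ) (f : Rd d → ℝ)
    (u : ℝ → Rd d → ℝ) : Prop where
  differentiableAt_time : ∀ t > 0, ∀ x ∈ D, DifferentiableAt ℝ (fun s => u s x) t
  continuousOn_deriv :
    ContinuousOn (fun p : ℝ × Rd d => deriv (fun s => u s p.2) p.1) (Ioi 0 ×ˢ D)
  continuousOn_caputo :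
    ContinuousOn (fun p : ℝ × Rd d => caputo β (fun s => u s p.2) p.1) (Ioi 0 ×ˢ D)
  contDiffOn_space : ∀ t > 0, ContDiffOn ℝ 2 (u t) D
  continuousOn_laplacian :
    ContinuousOn (fun p : ℝ × Rd d => Laplacian.laplacian (u p.1) p.2) (Ioi 0 ×ˢ D)
  deriv_bound : ∃ g : Rd d → ℝ, MemLp g ⊤ (volume.restrict D) ∧
    ∀ t > 0, ∀ x ∈ D, |deriv (fun s => u s x) t| ≤ g x * t ^ (β - 1)
  continuousOn_closure : ContinuousOn (fun p : ℝ × Rd d => u p.1 p.2) (Ici 0 ×ˢ closure D)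
  bounded : ∃ M : ℝ, ∀ t ≥ 0, ∀ x ∈ closure D, |u t x| ≤ M
  c1_closure : ∀ t > 0, IsC1Closure D (u t)
  equation : ∀ t > 0, ∀ x ∈ D, caputo β (fun s => u s x) t = Laplacian.laplacian (u t) x
  boundary : ∀ t > 0, ∀ x ∈ frontier D, u t x = 0
  initial : ∀ x ∈ D, u 0 x = f x

/-! ### The processes -/

/-- Brownian motion in `ℝ^d` started at `x` with generator `Δ`: continuous paths and independent
increments, `X_t - X_s` being centred Gaussian with covariance `2 (t - s) I`. -/
structure IsBrownianMotion {d : ℕ} {Ω : Type*} [MeasurableSpace Ω] (P : Measure Ω) (x : Rd d)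
    (X : ℝ≥0 → Ω → Rd d) : Prop where
  measurable : ∀ t, Measurable (X t)
  start : ∀ᵐ ω ∂P, X 0 ω = x
  indep : HasIndepIncrements X P
  law : ∀ s t, s ≤ t → HasLaw (fun ω => X t ω - X s ω)
    ((stdGaussian (Rd d)).map fun y => Real.sqrt (2 * ((t : ℝ) - s)) • y) P
  continuous : ∀ᵐ ω ∂P, Continuous fun t => X t ω

/-- Stable subordinator of index `β`: a Lévy process with nondecreasing right-continuous paths and
`E[exp(-θ S_t)] = exp(-t θ^β)`. -/
structure IsStableSubordinator {Ω : Type*} [MeasurableSpace Ω] (P : Measure Ω) (β : ℝ)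
    (S : ℝ≥0 → Ω → ℝ) : Prop where
  measurable : ∀ t, Measurable (S t)
  start : ∀ᵐ ω ∂P, S 0 ω = 0
  indep : HasIndepIncrements S P
  stationary : ∀ s t, IdentDistrib (fun ω => S (s + t) ω - S s ω) (S t) P P
  laplace : ∀ (t : ℝ≥0) (θ : ℝ), 0 < θ →
    ∫ ω, Real.exp (-θ * S t ω) ∂P = Real.exp (-t * θ ^ β)
  paths : ∀ᵐ ω ∂P, Monotone (fun t => S t ω) ∧
    ∀ t, ContinuousWithinAt (fun r => S r ω) (Ici t) t

/-- The inverse process `E_t = inf {r > 0 : S_r > t}`. -/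
def inverseProcess {Ω : Type*} (S : ℝ≥0 → Ω → ℝ) (t : ℝ≥0) (ω : Ω) : ℝ≥0 :=
  sInf {r : ℝ≥0 | 0 < r ∧ (t : ℝ) < S r ω}

/-- The time-changed process `(Y ∘ e)_t = Y_{e_t}`. -/
def timeChange {d : ℕ} {Ω : Type*} (Y : ℝ≥0 → Ω → Rd d) (e : ℝ≥0 → Ω → ℝ≥0) :
    ℝ≥0 → Ω → Rd d :=
  fun t ω => Y (e t ω) ω

/-- First exit time `τ_D(Y) = inf {t ≥ 0 : Y_t ∉ D}`, equal to `⊤` if `Y` never leaves `D`. -/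
def exitTime {d : ℕ} {Ω : Type*} (D : Set (Rd d)) (Y : ℝ≥0 → Ω → Rd d) : Ω → WithTop ℝ≥0 :=
  hittingAfter Y Dᶜ 0

end FracCauchy

end

open FracCauchy

/-! The proof compares Laplace transforms in time. Up to the factor `s`, the Laplace transform of a
function at `s` is its mean at an exponential time `T` of rate `s`; write `μ = s ^ β`.

Analytic side. For each fixed `t > 0`, Dynkin's formula for Brownian motion killed on leaving `D`
expresses `u(t, x)` as `μ⁻¹ ∫ (μ u(t, y) - Δu(t, y)) κ(dy)`, where `κ` is the law of the killed
process at an independent exponential time of rate `μ` (`eq_integral_killedLaw`). Average this over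
`t = T` and exchange the integrals. Since `Δu = ∂_t^β u`, and the Caputo derivative of `U` has mean
`μ (E U(T) - U(0))` (`integral_caputo_expTime`), the terms in `u` cancel. Hence `E u(T, x) = ∫ f dκ`
(`IsClassicalSolution.integral_expTime_eq`).

Probabilistic side. The events `{E_T ≥ a}` and `{S_a ≤ T}` have the same probability, namely `E
exp(-s S_a) = exp(-μ a)`. So `E_T` is exponential of rate `μ` (`map_inverseProcess_expTime`). As `E`
is independent of `X`, the killed value of `f` at time `E_T` also has mean `∫ f dκ`
(`integral_killedValue_inverseProcess`).

Both sides are bounded and right-continuous in `t`, so equal transforms give equality at every `t`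
(`eq_of_laplace_eq`). This covers starting points in `D`; on `∂D` both sides vanish.

Dynkin's formula is obtained without stochastic integrals. The process is sampled on a grid and
killed when it is seen outside a closed set `K`; the Markov property gives a telescoping sum whose
error is at most the supremum of `|w|` off `K`. The mesh then tends to `0`, and `K` exhausts `D`,
along which the error vanishes because `w = 0` on `∂D`.

The two events in the representation agree because `E` is continuous and nondecreasing from `0`, so
`X ∘ E` on `[0, t]` visits exactly the points visited by `X` on `[0, E_t]`. -/

noncomputable section

namespace FracCauchy

/-! ### Exponential times and Laplace transforms -/

/-- The law of an exponential time of rate `r`. -/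
def expTime (r : ℝ) : Measure ℝ :=
  (volume.restrict (Ioi 0)).withDensity fun t => ENNReal.ofReal (r * Real.exp (-(r * t)))

lemma expTime_absolutelyContinuous (r : ℝ) : expTime r ≪ volume.restrict (Ioi (0 : ℝ)) :=
  withDensity_absolutelyContinuous _ _

lemma ae_expTime_pos (r : ℝ) : ∀ᵐ t ∂expTime r, 0 < t :=
  (expTime_absolutelyContinuous r).ae_le (ae_restrict_mem measurableSet_Ioi)

lemma ae_expTime_ne (r c : ℝ) : ∀ᵐ t ∂expTime r, t ≠ c := by
  have h : ∀ᵐ t : ℝ, t ≠ c := by simp [ae_iff, measure_singleton]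
  exact ((expTime_absolutelyContinuous r).trans Measure.absolutelyContinuous_restrict).ae_le h

lemma integral_expTime {r : ℝ} (hr : 0 < r) (F : ℝ → ℝ) :
    ∫ t, F t ∂expTime r = ∫ t in Ioi (0 : ℝ), r * Real.exp (-(r * t)) * F t := by
  rw [expTime, integral_withDensity_eq_integral_toReal_smul (by fun_prop) (by simp)]
  refine integral_congr_ae (Eventually.of_forall fun t => ?_)
  have : 0 ≤ r * Real.exp (-(r * t)) := by positivity
  simp [ENNReal.toReal_ofReal this]

lemma integrableOn_exp_density {r : ℝ} (hr : 0 < r) (a : ℝ) :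
    IntegrableOn (fun t => r * Real.exp (-(r * t))) (Ioi a) := by
  have := (integrableOn_exp_mul_Ioi (a := -r) (by linarith) a).const_mul r
  simp only [neg_mul] at this
  exact this

lemma expTime_Ioi {r a : ℝ} (hr : 0 < r) (ha : 0 ≤ a) :
    expTime r (Ioi a) = ENNReal.ofReal (Real.exp (-(r * a))) := by
  rw [expTime, withDensity_apply _ measurableSet_Ioi, Measure.restrict_restrict measurableSet_Ioi,
    inter_eq_left.2 (Ioi_subset_Ioi ha), ← ofReal_integral_eq_lintegral_ofReal
      (integrableOn_exp_density hr a) (Eventually.of_forall fun t => by positivity)]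
  congr 1
  have := integral_exp_mul_Ioi (a := -r) (by linarith) a
  rw [integral_const_mul]
  simp only [neg_mul] at this
  rw [this]
  field_simp

lemma isProbabilityMeasure_expTime {r : ℝ} (hr : 0 < r) : IsProbabilityMeasure (expTime r) := by
  constructor
  have h1 := expTime_Ioi hr le_rfl
  have h2 : expTime r univ = expTime r (Ioi 0) := by
    apply measure_congr
    filter_upwards [ae_expTime_pos r] with t ht
    exact propext ⟨fun _ => ht, fun _ => trivial⟩
  rw [h2, h1]
  simp

lemma integrable_of_bound_expTime {r M : ℝ} (hr : 0 < r) {F : ℝ → ℝ}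
    (hF : AEStronglyMeasurable F (volume.restrict (Ioi 0))) (hM : ∀ t > 0, |F t| ≤ M) :
    Integrable F (expTime r) := by
  have := isProbabilityMeasure_expTime hr
  refine Integrable.of_bound (hF.mono_ac (expTime_absolutelyContinuous r)) M ?_
  filter_upwards [ae_expTime_pos r] with t ht using hM t ht

lemma integrableOn_exp_mul_of_bound {r M : ℝ} (hr : 0 < r) {F : ℝ → ℝ}
    (hF : AEStronglyMeasurable F (volume.restrict (Ioi 0))) (hM : ∀ t > 0, |F t| ≤ M) :
    IntegrableOn (fun t => r * Real.exp (-(r * t)) * F t) (Ioi 0) := by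
  refine Integrable.mul_bdd (c := M) (integrableOn_exp_density hr 0) hF ?_
  filter_upwards [ae_restrict_mem measurableSet_Ioi] with t ht using hM t ht

/-- A bounded function on the half line is determined by its Laplace transform:
version for densities bounded below by `1`. -/
lemma ae_eq_of_laplace_eq_of_one_le {a b : ℝ → ℝ} {M : ℝ} (ha : Measurable a) (hb : Measurable b)
    (ha1 : ∀ t, 1 ≤ a t) (hb1 : ∀ t, 1 ≤ b t) (haM : ∀ t, a t ≤ M) (hbM : ∀ t, b t ≤ M)
    (h : ∀ s > 0, ∫ t, a t ∂expTime s = ∫ t, b t ∂expTime s) :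
    a =ᵐ[volume.restrict (Ioi 0)] b := by
  -- The weight `exp (-t)` makes the measure finite and places `0` in the interior of the domain `θ
  -- < 1` of its moment generating function. The Laplace variable is `s = 1 - θ`.
  have key : ∀ c : ℝ → ℝ, Measurable c → (∀ t, 1 ≤ c t) → (∀ t, c t ≤ M) →
      let μ := (volume.restrict (Ioi (0 : ℝ))).withDensity
        fun t => ENNReal.ofReal (Real.exp (-t) * c t)
      IsFiniteMeasure μ ∧ μ ≠ 0 ∧ (∀ θ, θ < 1 → Integrable (fun t => Real.exp (θ * t)) μ) ∧
      (∀ θ, 1 ≤ θ → mgf id μ θ = 0) ∧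
      (∀ θ, θ < 1 → mgf id μ θ = (1 - θ)⁻¹ * ∫ t, c t ∂expTime (1 - θ)) := by
    intro c hc hc1 hcM μ
    have hpos : ∀ t, 0 ≤ Real.exp (-t) * c t := fun t =>
      mul_nonneg (Real.exp_nonneg _) (by linarith [hc1 t])
    have hint : ∀ θ : ℝ, (Integrable (fun t => Real.exp (θ * t)) μ ↔
        IntegrableOn (fun t => Real.exp (-((1 - θ) * t)) * c t) (Ioi 0)) := by
      intro θ
      rw [integrable_withDensity_iff (by fun_prop) (by simp), IntegrableOn]
      refine integrable_congr (Eventually.of_forall fun t => ?_)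
      simp only [ENNReal.toReal_ofReal (hpos t)]
      rw [← mul_assoc, ← Real.exp_add]
      ring_nf
    have hgood : ∀ θ : ℝ, θ < 1 →
        IntegrableOn (fun t => (1 - θ) * Real.exp (-((1 - θ) * t)) * c t) (Ioi 0) := fun θ hθ =>
      integrableOn_exp_mul_of_bound (M := M) (by linarith) hc.aestronglyMeasurable
        fun t _ => abs_le.2 ⟨by linarith [hc1 t, hcM t], hcM t⟩
    have hint1 : ∀ θ : ℝ, θ < 1 → Integrable (fun t => Real.exp (θ * t)) μ := by
      intro θ hθ
      rw [hint]
      have := (hgood θ hθ).const_mul (1 - θ)⁻¹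
      have h1 : (1 - θ) ≠ 0 := by linarith
      refine this.congr (Eventually.of_forall fun t => ?_)
      simp only
      field_simp
    have hmgf : ∀ θ, mgf id μ θ = ∫ t in Ioi (0 : ℝ), Real.exp (-((1 - θ) * t)) * c t := by
      intro θ
      simp only [mgf, id]
      rw [integral_withDensity_eq_integral_toReal_smul (by fun_prop) (by simp)]
      refine integral_congr_ae (Eventually.of_forall fun t => ?_)
      simp only [ENNReal.toReal_ofReal (hpos t), smul_eq_mul]
      rw [mul_right_comm, ← Real.exp_add]
      ring_nf
    refine ⟨?_, ?_, hint1, ?_, ?_⟩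
    · have := hint1 0 (by norm_num)
      simp only [zero_mul, Real.exp_zero] at this
      exact (integrable_const_iff_isFiniteMeasure one_ne_zero).1 this
    · intro h0
      rw [withDensity_eq_zero_iff (by fun_prop)] at h0
      have h1 : ∀ᵐ t ∂(volume.restrict (Ioi (0 : ℝ))), False := by
        filter_upwards [h0] with t ht
        simp only [Pi.zero_apply, ENNReal.ofReal_eq_zero] at ht
        have : 0 < Real.exp (-t) * c t := mul_pos (Real.exp_pos _) (by linarith [hc1 t])
        linarith
      rw [ae_iff] at h1
      simp at h1
    · intro θ hθ
      -- For `θ ≥ 1` the integrand is at least `1` on the half line, so the integral takes its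
      -- default value `0`. The bound `1 ≤ c` is there for this: the two generating functions then
      -- agree for every `θ`.
      refine integral_undef fun hcon => ?_
      have h1 := (hint θ).1 hcon
      have h2 : IntegrableOn (fun _ : ℝ => (1 : ℝ)) (Ioi 0) := by
        refine Integrable.mono h1 (by fun_prop) ?_
        filter_upwards [ae_restrict_mem measurableSet_Ioi] with t ht
        have ht : 0 < t := ht
        have h3 : 1 ≤ Real.exp (-((1 - θ) * t)) := Real.one_le_exp (by nlinarith)
        rw [norm_one, Real.norm_eq_abs]
        exact (one_le_mul_of_one_le_of_one_le h3 (hc1 t)).trans (le_abs_self _)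
      rw [IntegrableOn, integrable_const_iff_isFiniteMeasure one_ne_zero] at h2
      have := h2.measure_univ_lt_top
      simp at this
    · intro θ hθ
      have h1 : (1 - θ) ≠ 0 := by linarith
      rw [hmgf, integral_expTime (by linarith), ← integral_const_mul]
      refine integral_congr_ae (Eventually.of_forall fun t => ?_)
      simp only
      field_simp
  obtain ⟨fa, na, ia, za, la⟩ := key a ha ha1 haM
  obtain ⟨fb, nb, ib, zb, lb⟩ := key b hb hb1 hbM
  set μ := (volume.restrict (Ioi (0 : ℝ))).withDensity
        fun t => ENNReal.ofReal (Real.exp (-t) * a t)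
  set ν := (volume.restrict (Ioi (0 : ℝ))).withDensity
        fun t => ENNReal.ofReal (Real.exp (-t) * b t)
  have hmgf : mgf id μ = mgf id ν := by
    ext θ
    rcases lt_or_ge θ 1 with hθ | hθ
    · rw [la θ hθ, lb θ hθ, h _ (by linarith)]
    · rw [za θ hθ, zb θ hθ]
  -- Equality on the real axis extends analytically to the strip over the interior of the domain.
  -- That strip contains the imaginary axis, where the transform is the characteristic function.
  have hEq := eqOn_complexMGF_of_mgf' hmgf (by simp [na, nb])
  have h0 : (0 : ℝ) ∈ interior (integrableExpSet id μ) := by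
    rw [mem_interior]
    exact ⟨Iio 1, fun θ hθ => ia θ hθ, isOpen_Iio, by simp⟩
  have hμν : μ = ν := by
    refine Measure.ext_of_charFun ?_
    ext t
    rw [← complexMGF_id_mul_I, ← complexMGF_id_mul_I]
    exact hEq (by simpa using h0)
  have := (withDensity_eq_iff (μ := volume.restrict (Ioi (0 : ℝ))) (by fun_prop) (by fun_prop)
    (by have := fa.measure_univ_lt_top.ne
        rwa [withDensity_apply _ MeasurableSet.univ, Measure.restrict_univ] at this)).1 hμν
  filter_upwards [this] with t ht
  rw [ENNReal.ofReal_eq_ofReal_iff] at ht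
  · exact mul_left_cancel₀ (Real.exp_ne_zero _) ht
  · exact mul_nonneg (Real.exp_nonneg _) (by linarith [ha1 t])
  · exact mul_nonneg (Real.exp_nonneg _) (by linarith [hb1 t])

/-- A bounded function on the half line is determined by its Laplace transform. -/
lemma ae_eq_of_laplace_eq {a b : ℝ → ℝ} {M : ℝ}
    (ha : AEStronglyMeasurable a (volume.restrict (Ioi 0)))
    (hb : AEStronglyMeasurable b (volume.restrict (Ioi 0)))
    (haM : ∀ t > 0, |a t| ≤ M) (hbM : ∀ t > 0, |b t| ≤ M)
    (h : ∀ s > 0, ∫ t, a t ∂expTime s = ∫ t, b t ∂expTime s) :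
    a =ᵐ[volume.restrict (Ioi 0)] b := by
  have key : ∀ c : ℝ → ℝ, AEStronglyMeasurable c (volume.restrict (Ioi 0)) →
      (∀ t > 0, |c t| ≤ M) → ∃ c' : ℝ → ℝ, Measurable c' ∧ (∀ t, 1 ≤ c' t) ∧
      (∀ t, c' t ≤ |M| + |M| + 1) ∧ c' =ᵐ[volume.restrict (Ioi 0)] fun t => c t + |M| + 1 := by
    intro c hc hcM
    -- A measurable version of `c`, clipped to `[-|M|, |M|]` and shifted by `|M| + 1`, meets the
    -- bounds everywhere.
    refine ⟨fun t => max (-|M|) (min |M| (hc.mk c t)) + |M| + 1, ?_, ?_, ?_, ?_⟩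
    · have := hc.stronglyMeasurable_mk.measurable
      fun_prop
    · intro t
      linarith [le_max_left (-|M|) (min |M| (hc.mk c t))]
    · intro t
      have : max (-|M|) (min |M| (hc.mk c t)) ≤ |M| :=
        max_le (by linarith [abs_nonneg M]) (min_le_left _ _)
      linarith
    · filter_upwards [hc.ae_eq_mk, ae_restrict_mem measurableSet_Ioi] with t ht h0
      rw [← ht]
      have := abs_le.1 ((hcM t h0).trans (le_abs_self M))
      rw [min_eq_right this.2, max_eq_right this.1]
  obtain ⟨a', ma, a1, aM, ea⟩ := key a ha haM
  obtain ⟨b', mb, b1, bM, eb⟩ := key b hb hbM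
  have h' : ∀ s > 0, ∫ t, a' t ∂expTime s = ∫ t, b' t ∂expTime s := by
    intro s hs
    have := isProbabilityMeasure_expTime hs
    rw [integral_congr_ae ((expTime_absolutelyContinuous s).ae_le ea),
      integral_congr_ae ((expTime_absolutelyContinuous s).ae_le eb)]
    simp_rw [add_assoc]
    rw [integral_add (integrable_of_bound_expTime hs ha haM) (integrable_const _),
      integral_add (integrable_of_bound_expTime hs hb hbM) (integrable_const _), h s hs]
  filter_upwards [ea, eb, ae_eq_of_laplace_eq_of_one_le ma mb a1 b1 aM bM h'] with t h1 h2 h3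
  linarith

/-- Right-continuous bounded functions with equal Laplace transforms agree everywhere. -/
lemma eq_of_laplace_eq {a b : ℝ → ℝ} {M : ℝ}
    (ha : AEStronglyMeasurable a (volume.restrict (Ioi 0)))
    (hb : AEStronglyMeasurable b (volume.restrict (Ioi 0)))
    (haM : ∀ t > 0, |a t| ≤ M) (hbM : ∀ t > 0, |b t| ≤ M)
    (h : ∀ s > 0, ∫ t, a t ∂expTime s = ∫ t, b t ∂expTime s) {t : ℝ} (ht : 0 ≤ t)
    (hac : ContinuousWithinAt a (Ioi t) t) (hbc : ContinuousWithinAt b (Ioi t) t) :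
    a t = b t := by
  have hae := ae_eq_of_laplace_eq ha hb haM hbM h
  rw [Filter.EventuallyEq, ae_restrict_iff' measurableSet_Ioi] at hae
  -- Every interval to the right of `t` has positive length, so it meets the set of full measure
  -- where `a = b`.
  have hfreq : ∃ᶠ s in 𝓝[>] t, a s = b s := by
    rw [frequently_nhdsWithin_iff, frequently_nhds_iff]
    intro U hU htU
    obtain ⟨ε, hε, hball⟩ := Metric.mem_nhds_iff.1 (htU.mem_nhds hU)
    have hvol : volume (Ioo t (t + ε)) ≠ 0 := by simp [hε]
    obtain ⟨s, hs, hs'⟩ := ((frequently_ae_mem_iff.2 hvol).and_eventually hae).exists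
    refine ⟨s, hball ?_, hs' (lt_of_le_of_lt ht hs.1), hs.1⟩
    rw [Metric.mem_ball, Real.dist_eq, abs_of_pos (by linarith [hs.1])]
    linarith [hs.2]
  exact tendsto_nhds_unique_of_frequently_eq hac hbc hfreq

/-! ### The Caputo derivative -/

/-- This is the integrand of the beta function at `(β, 1 - β)`, which the substitution `s = t p`
produces from `s ^ (β - 1) / (t - s) ^ β`. All powers of `t` cancel, so the resulting bound is
uniform in time. -/
lemma intervalIntegrable_beta {β : ℝ} (hβ : β ∈ Ioo (0 : ℝ) 1) :
    IntervalIntegrable (fun p : ℝ => p ^ (β - 1) * (1 - p) ^ (-β)) volume 0 1 := by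
  have := (Complex.betaIntegral_convergent (u := (β : ℂ)) (v := ((1 - β : ℝ) : ℂ))
    (by simpa using hβ.1) (by simpa using hβ.2)).norm
  rw [intervalIntegrable_iff_integrableOn_Ioo_of_le zero_le_one] at this ⊢
  refine this.congr_fun (fun p hp => ?_) measurableSet_Ioo
  have h1 : (1 - (p : ℂ)) = ((1 - p : ℝ) : ℂ) := by push_cast; ring
  simp only [norm_mul]
  rw [h1, Complex.norm_cpow_eq_rpow_re_of_pos hp.1,
    Complex.norm_cpow_eq_rpow_re_of_pos (by linarith [hp.2])]
  simp

/-- If `|U'(t)| ≤ g t^(β-1)` then the Caputo derivative of `U` is bounded by a multiple of `g`. -/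
lemma exists_abs_caputo_le {β : ℝ} (hβ : β ∈ Ioo (0 : ℝ) 1) :
    ∃ C : ℝ, 0 ≤ C ∧ ∀ (U : ℝ → ℝ) (g : ℝ), (∀ t > 0, |deriv U t| ≤ g * t ^ (β - 1)) →
      ∀ t > 0, |caputo β U t| ≤ C * g := by
  refine ⟨|(Real.Gamma (1 - β))⁻¹| * ∫ p in (0 : ℝ)..1, p ^ (β - 1) * (1 - p) ^ (-β), ?_, ?_⟩
  · refine mul_nonneg (abs_nonneg _) (intervalIntegral.integral_nonneg zero_le_one fun p hp => ?_)
    exact mul_nonneg (Real.rpow_nonneg hp.1 _) (Real.rpow_nonneg (by linarith [hp.2]) _)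
  intro U g hg t ht
  rw [caputo, abs_mul, mul_assoc]
  refine mul_le_mul_of_nonneg_left ?_ (abs_nonneg _)
  have hsub := intervalIntegral.mul_integral_comp_mul_left (a := 0) (b := 1)
    (f := fun s => deriv U s / (t - s) ^ β) t
  rw [mul_zero, mul_one] at hsub
  rw [← hsub, ← intervalIntegral.integral_const_mul, ← Real.norm_eq_abs,
    ← intervalIntegral.integral_mul_const]
  refine intervalIntegral.norm_integral_le_of_norm_le zero_le_one ?_
    ((intervalIntegrable_beta hβ).mul_const g)
  have hne : ∀ᵐ p : ℝ, p ≠ 1 := by simp [ae_iff, measure_singleton]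
  filter_upwards [hne] with p hp1 hp
  have hp0 : 0 < p := hp.1
  have hp1 : 0 < 1 - p := by
    have := lt_of_le_of_ne hp.2 hp1
    linarith
  rw [show t - t * p = t * (1 - p) by ring, Real.mul_rpow ht.le hp1.le, Real.norm_eq_abs, abs_mul,
    abs_div, abs_of_pos ht, abs_mul, abs_of_pos (Real.rpow_pos_of_pos ht _),
    abs_of_pos (Real.rpow_pos_of_pos hp1 _)]
  have h1 := hg (t * p) (by positivity)
  rw [Real.mul_rpow ht.le hp0.le, Real.rpow_sub_one ht.ne'] at h1
  have h2 : 0 < t ^ β := Real.rpow_pos_of_pos ht _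
  have h3 : 0 < (1 - p) ^ β := Real.rpow_pos_of_pos hp1 _
  rw [Real.rpow_neg hp1.le]
  calc t * (|deriv U (t * p)| / (t ^ β * (1 - p) ^ β))
      ≤ t * (g * (t ^ β / t * p ^ (β - 1)) / (t ^ β * (1 - p) ^ β)) := by gcongr
    _ = p ^ (β - 1) * ((1 - p) ^ β)⁻¹ * g := by field_simp

/-- The Laplace transform of the Caputo derivative. -/
lemma integral_caputo_expTime {β : ℝ} (hβ : β ∈ Ioo (0 : ℝ) 1) {U : ℝ → ℝ} {g M : ℝ}
    (hd : ∀ t > 0, DifferentiableAt ℝ U t) (hc : ContinuousWithinAt U (Ici 0) 0)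
    (hM : ∀ t ≥ 0, |U t| ≤ M) (hg : ∀ t > 0, |deriv U t| ≤ g * t ^ (β - 1))
    {s : ℝ} (hs : 0 < s) :
    ∫ t, caputo β U t ∂expTime s = s ^ β * (∫ t, U t ∂expTime s - U 0) := by
  have hUm : AEStronglyMeasurable U (volume.restrict (Ioi 0)) :=
    ContinuousOn.aestronglyMeasurable
      (fun t ht => (hd t ht).continuousAt.continuousWithinAt) measurableSet_Ioi
  have hg0 : IntegrableOn (fun t : ℝ => Real.exp (-(s * t)) * t ^ (β - 1)) (Ioi 0) := by
    have := integrableOn_rpow_mul_exp_neg_mul_rpow (p := 1) (s := β - 1) (b := s)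
      (by linarith [hβ.1]) one_pos hs
    refine this.congr_fun (fun t _ => ?_) measurableSet_Ioi
    simp [mul_comm]
  have hf : IntegrableOn (fun t => Real.exp (-(s * t)) * deriv U t) (Ioi 0) := by
    refine Integrable.mono' (hg0.mul_const g) ?_ ?_
    · have := measurable_deriv U
      exact (Measurable.aestronglyMeasurable (by fun_prop))
    · filter_upwards [ae_restrict_mem measurableSet_Ioi] with t ht
      rw [norm_mul, Real.norm_eq_abs, Real.norm_eq_abs, abs_of_pos (Real.exp_pos _), mul_assoc]
      refine mul_le_mul_of_nonneg_left ?_ (Real.exp_nonneg _)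
      rw [mul_comm]
      exact hg t ht
  have hp : IntegrableOn (fun t : ℝ => Real.exp (-(s * t)) * t ^ (-β)) (Ioi 0) := by
    have := integrableOn_rpow_mul_exp_neg_mul_rpow (p := 1) (s := -β) (b := s)
      (by linarith [hβ.2]) one_pos hs
    refine this.congr_fun (fun t _ => ?_) measurableSet_Ioi
    simp [mul_comm]
  have hpint : ∫ t in Ioi (0 : ℝ), Real.exp (-(s * t)) * t ^ (-β)
      = s ^ (β - 1) * Real.Gamma (1 - β) := by
    have := Real.integral_rpow_mul_exp_neg_mul_Ioi (a := 1 - β) (by linarith [hβ.2]) hs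
    rw [one_div, Real.inv_rpow hs.le, ← Real.rpow_neg hs.le, neg_sub] at this
    rw [← this]
    refine setIntegral_congr_fun measurableSet_Ioi fun t _ => ?_
    simp only [show (1 - β - 1) = -β by ring]
    ring
  have hfint : ∫ t in Ioi (0 : ℝ), Real.exp (-(s * t)) * deriv U t
      = ∫ t, U t ∂expTime s - U 0 := by
    -- Integration by parts: the fundamental theorem of calculus on the half line for `exp (-(s t))
    -- U(t)`, which tends to `0` at infinity and to `U 0` at `0`.
    have hI := integrableOn_exp_mul_of_bound hs hUm fun t ht => hM t ht.le
    have hft := integral_Ioi_of_hasDerivAt_of_tendsto (a := 0) (m := 0)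
      (f := fun t => Real.exp (-(s * t)) * U t)
      (f' := fun t => Real.exp (-(s * t)) * deriv U t - s * Real.exp (-(s * t)) * U t)
      ?_ ?_ (hf.sub hI) ?_
    · rw [integral_sub hf hI] at hft
      rw [integral_expTime hs]
      simp only [mul_zero, neg_zero, Real.exp_zero, one_mul] at hft
      linarith
    · exact ContinuousWithinAt.mul (by fun_prop) hc
    · intro t ht
      have h1 : HasDerivAt (fun t => Real.exp (-(s * t))) (Real.exp (-(s * t)) * (-s)) t := by
        have : HasDerivAt (fun t => -(s * t)) (-s) t := by
          convert! ((hasDerivAt_id t).const_mul s).neg using 1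
          simp
        exact this.exp
      convert! h1.mul (hd t ht).hasDerivAt using 1
      ring
    · have h1 : Tendsto (fun t => Real.exp (-(s * t)) * M) atTop (𝓝 0) := by
        have : Tendsto (fun t : ℝ => Real.exp (-(s * t))) atTop (𝓝 0) :=
          Real.tendsto_exp_neg_atTop_nhds_zero.comp (tendsto_id.const_mul_atTop hs)
        simpa using this.mul_const M
      refine squeeze_zero_norm' ?_ h1
      filter_upwards [eventually_ge_atTop 0] with t ht
      rw [norm_mul, Real.norm_eq_abs, Real.norm_eq_abs, abs_of_pos (Real.exp_pos _)]
      exact mul_le_mul_of_nonneg_left (hM t ht) (Real.exp_nonneg _)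
  -- Writing `exp (-s t) = exp (-s r) exp (-s (t - r))` turns the discounted Caputo integral into a
  -- convolution on the half line, whose integral is the product of `hfint` and `hpint`. The factor
  -- `Γ(1 - β)` from `hpint` cancels the normalisation.
  have hconv := integral_posConvolution hf hp (ContinuousLinearMap.mul ℝ ℝ)
  rw [ContinuousLinearMap.mul_apply', hfint, hpint] at hconv
  rw [integral_expTime hs]
  have h1 : ∀ t ∈ Ioi (0 : ℝ), s * Real.exp (-(s * t)) * caputo β U t =
      s * (Real.Gamma (1 - β))⁻¹ * ∫ r in (0 : ℝ)..t, (ContinuousLinearMap.mul ℝ ℝ)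
        (Real.exp (-(s * r)) * deriv U r) (Real.exp (-(s * (t - r))) * (t - r) ^ (-β)) := by
    intro t ht
    have : ∫ r in (0 : ℝ)..t, (ContinuousLinearMap.mul ℝ ℝ)
        (Real.exp (-(s * r)) * deriv U r) (Real.exp (-(s * (t - r))) * (t - r) ^ (-β)) =
        ∫ r in (0 : ℝ)..t, Real.exp (-(s * t)) * (deriv U r / (t - r) ^ β) := by
      refine intervalIntegral.integral_congr fun r hr => ?_
      rw [uIcc_of_le (le_of_lt ht)] at hr
      simp only [ContinuousLinearMap.mul_apply']
      rw [Real.rpow_neg (by linarith [hr.2]), show -(s * t) = -(s * r) + -(s * (t - r)) by ring,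
        Real.exp_add]
      ring
    rw [this, intervalIntegral.integral_const_mul, caputo]
    ring
  rw [setIntegral_congr_fun measurableSet_Ioi h1, integral_const_mul, hconv]
  have hG : Real.Gamma (1 - β) ≠ 0 := (Real.Gamma_pos_of_pos (by linarith [hβ.2])).ne'
  rw [Real.rpow_sub_one hs.ne']
  field_simp

/-! ### The generator of Brownian motion -/

section Generator

variable {d : ℕ}

/-- Cauchy's mean value theorem on `[0, 1]`, for the first-order Taylor remainder at `y + θ v` as a
function of `θ` against `(1 - θ) ^ 2`. In the derivative of the remainder only the Hessian term
survives. -/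
lemma exists_taylor_two {w : Rd d → ℝ} (hw : ContDiff ℝ 2 w) (y v : Rd d) :
    ∃ ξ ∈ Ioo (0 : ℝ) 1, w (y + v) - w y - fderiv ℝ w y v
      = fderiv ℝ (fderiv ℝ w) (y + ξ • v) v v / 2 := by
  have hw1 : Differentiable ℝ w := hw.differentiable (by norm_num)
  have hw2 : Differentiable ℝ (fderiv ℝ w) :=
    (hw.fderiv_right (m := 1) (by norm_num)).differentiable (by norm_num)
  have hline : ∀ θ : ℝ, HasDerivAt (fun θ : ℝ => y + θ • v) v θ := by
    intro θ
    simpa using ((hasDerivAt_id θ).smul_const v).const_add y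
  have hg : ∀ θ : ℝ, HasDerivAt (fun θ : ℝ => w (y + θ • v)) (fderiv ℝ w (y + θ • v) v) θ :=
    fun θ => (hw1 _).hasFDerivAt.comp_hasDerivAt θ (hline θ)
  have hg' : ∀ θ : ℝ, HasDerivAt (fun θ : ℝ => fderiv ℝ w (y + θ • v) v)
      (fderiv ℝ (fderiv ℝ w) (y + θ • v) v v) θ := fun θ => by
    have := (hw2 (y + θ • v)).hasFDerivAt.comp_hasDerivAt θ (hline θ)
    simpa using this.clm_apply (hasDerivAt_const θ v)
  have hF : ∀ θ : ℝ, HasDerivAt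
      (fun θ : ℝ => w (y + v) - w (y + θ • v) - (1 - θ) * fderiv ℝ w (y + θ • v) v)
      (-((1 - θ) * fderiv ℝ (fderiv ℝ w) (y + θ • v) v v)) θ := fun θ => by
    have h1 : HasDerivAt (fun θ : ℝ => 1 - θ) (-1) θ := by
      simpa using (hasDerivAt_id θ).const_sub 1
    convert! ((hg θ).const_sub (w (y + v))).sub (h1.mul (hg' θ)) using 1
    ring
  have hG : ∀ θ : ℝ, HasDerivAt (fun θ : ℝ => (1 - θ) ^ 2) (-(2 * (1 - θ))) θ := fun θ => by
    have h1 : HasDerivAt (fun θ : ℝ => 1 - θ) (-1) θ := by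
      simpa using (hasDerivAt_id θ).const_sub 1
    convert! h1.pow 2 using 1
    ring
  obtain ⟨c, hc, hcc⟩ := exists_ratio_hasDerivAt_eq_ratio_slope _ _ zero_lt_one
    (fun θ _ => (hF θ).continuousAt.continuousWithinAt) (fun θ _ => hF θ) _ _
    (fun θ _ => (hG θ).continuousAt.continuousWithinAt) (fun θ _ => hG θ)
  refine ⟨c, hc, ?_⟩
  simp only [one_smul, zero_smul, add_zero, sub_self, zero_mul, sub_zero, one_mul] at hcc
  have h1 : 1 - c ≠ 0 := by linarith [hc.2]
  have h2 : (1 - c) * (fderiv ℝ (fderiv ℝ w) (y + c • v) v v) =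
      (1 - c) * (2 * (w (y + v) - w y - fderiv ℝ w y v)) := by linarith
  have h3 := mul_left_cancel₀ h1 h2
  rw [h3]
  ring

lemma laplacian_eq_sum_fderiv (w : Rd d → ℝ) (y : Rd d) :
    Laplacian.laplacian w y = ∑ i, fderiv ℝ (fderiv ℝ w) y
      (EuclideanSpace.basisFun (Fin d) ℝ i) (EuclideanSpace.basisFun (Fin d) ℝ i) := by
  rw [InnerProductSpace.laplacian_eq_iteratedFDeriv_orthonormalBasis w
    (EuclideanSpace.basisFun (Fin d) ℝ)]
  simp [iteratedFDeriv_two_apply]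

lemma integrable_norm_sq_stdGaussian :
    Integrable (fun z : Rd d => ‖z‖ ^ 2) (stdGaussian (Rd d)) := by
  simpa using (IsGaussian.memLp_two_id (μ := stdGaussian (Rd d))).integrable_norm_pow two_ne_zero

lemma integral_coord_mul_coord_stdGaussian (i j : Fin d) :
    Integrable (fun z : Rd d => z i * z j) (stdGaussian (Rd d)) ∧
    ∫ z : Rd d, z i * z j ∂stdGaussian (Rd d) = if i = j then 1 else 0 := by
  constructor
  · refine Integrable.mono' integrable_norm_sq_stdGaussian (by fun_prop)
      (Eventually.of_forall fun z => ?_)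
    rw [norm_mul, sq]
    exact mul_le_mul (PiLp.norm_apply_le z i) (PiLp.norm_apply_le z j) (norm_nonneg _)
      (norm_nonneg _)
  · have h := covarianceBilin_apply (IsGaussian.memLp_two_id (μ := stdGaussian (Rd d)))
      (EuclideanSpace.basisFun (Fin d) ℝ i) (EuclideanSpace.basisFun (Fin d) ℝ j)
    rw [covarianceBilin_stdGaussian] at h
    simp only [id, integral_id_stdGaussian, sub_zero, EuclideanSpace.basisFun_apply,
      EuclideanSpace.inner_single_left, map_one, one_mul] at h
    rw [← h, innerSL_apply_apply]
    simp [EuclideanSpace.inner_single_left]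

/-- The coordinates of a standard Gaussian vector are uncorrelated with unit variance, so only the
trace of `B` remains. With `B` the Hessian, this is where the Laplacian comes from. -/
lemma integral_bilin_stdGaussian (B : Rd d →L[ℝ] Rd d →L[ℝ] ℝ) :
    ∫ z, B z z ∂stdGaussian (Rd d) = ∑ i, B (EuclideanSpace.basisFun (Fin d) ℝ i)
      (EuclideanSpace.basisFun (Fin d) ℝ i) := by
  have hB : ∀ z : Rd d, B z z = ∑ i, ∑ j, z i * z j *
      B (EuclideanSpace.basisFun (Fin d) ℝ i) (EuclideanSpace.basisFun (Fin d) ℝ j) := by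
    intro z
    have hz := (EuclideanSpace.basisFun (Fin d) ℝ).sum_repr z
    simp only [EuclideanSpace.basisFun_repr] at hz
    conv_lhs => rw [← hz]
    simp only [map_sum, map_smul, sum_apply, smul_apply,
      smul_eq_mul, Finset.mul_sum, mul_assoc]
    rw [Finset.sum_comm]
    refine Finset.sum_congr rfl fun i _ => Finset.sum_congr rfl fun j _ => ?_
    ring
  simp_rw [hB]
  rw [integral_finsetSum _ fun i _ => integrable_finsetSum _ fun j _ =>
    (integral_coord_mul_coord_stdGaussian i j).1.mul_const _]
  refine Finset.sum_congr rfl fun i _ => ?_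
  rw [integral_finsetSum _ fun j _ => (integral_coord_mul_coord_stdGaussian i j).1.mul_const _]
  simp [integral_mul_const, (integral_coord_mul_coord_stdGaussian i _).2]

/-- The transition operator of Brownian motion with generator `Δ`. -/
def heatStep (h : ℝ) (w : Rd d → ℝ) (y : Rd d) : ℝ :=
  ∫ z, w (y + Real.sqrt (2 * h) • z) ∂stdGaussian (Rd d)

/-- The gradient term is odd and integrates to zero. Subtracting it makes the integrand of second
order in the increment, so that dividing by `h` is harmless. -/
lemma heatStep_sub_eq {w : Rd d → ℝ} (hw : ContDiff ℝ 2 w) (hc : HasCompactSupport w) (h : ℝ)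
    (y : Rd d) :
    (heatStep h w y - w y) / h = ∫ z, (w (y + Real.sqrt (2 * h) • z) - w y
      - fderiv ℝ w y (Real.sqrt (2 * h) • z)) / h ∂stdGaussian (Rd d) := by
  obtain ⟨C, hC⟩ := hc.exists_bound_of_continuous hw.continuous
  have hwc := hw.continuous
  have i1 : Integrable (fun z => w (y + Real.sqrt (2 * h) • z)) (stdGaussian (Rd d)) :=
    Integrable.of_bound (Continuous.aestronglyMeasurable (by fun_prop)) C
      (Eventually.of_forall fun z => hC _)
  have i2 : Integrable (fun z => fderiv ℝ w y (Real.sqrt (2 * h) • z)) (stdGaussian (Rd d)) := by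
    have : Integrable (fun z : Rd d => z) (stdGaussian (Rd d)) := IsGaussian.integrable_id
    simp only [map_smul, smul_eq_mul]
    exact ((fderiv ℝ w y).integrable_comp this).const_mul _
  have i3 : Integrable (fun z => w (y + Real.sqrt (2 * h) • z) - w y) (stdGaussian (Rd d)) :=
    i1.sub (integrable_const _)
  rw [integral_div, integral_sub i3 i2,
    integral_sub i1 (integrable_const _)]
  simp only [map_smul, integral_smul, integral_strongDual_stdGaussian]
  simp [heatStep]

/-- The variance `2 h` cancels both the Taylor factor `1 / 2` and the division by `h`. This is why
the generator is `Δ` and not `Δ / 2`. -/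
lemma taylor_quotient {w : Rd d → ℝ} (hw : ContDiff ℝ 2 w) {h : ℝ} (hh : 0 < h) (y z : Rd d) :
    ∃ ξ ∈ Ioo (0 : ℝ) 1, (w (y + Real.sqrt (2 * h) • z) - w y
      - fderiv ℝ w y (Real.sqrt (2 * h) • z)) / h
      = fderiv ℝ (fderiv ℝ w) (y + ξ • Real.sqrt (2 * h) • z) z z := by
  obtain ⟨ξ, hξ, he⟩ := exists_taylor_two hw y (Real.sqrt (2 * h) • z)
  refine ⟨ξ, hξ, ?_⟩
  rw [he]
  simp only [map_smul, smul_apply, smul_eq_mul]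
  have := Real.mul_self_sqrt (show 0 ≤ 2 * h by linarith)
  rw [← mul_assoc, this]
  field_simp

lemma exists_hessian_bound {w : Rd d → ℝ} (hw : ContDiff ℝ 2 w) (hc : HasCompactSupport w) :
    ∃ C, ∀ y z, |fderiv ℝ (fderiv ℝ w) y z z| ≤ C * ‖z‖ ^ 2 := by
  have hcont : Continuous (fderiv ℝ (fderiv ℝ w)) :=
    (hw.fderiv_right (m := 1) (by norm_num)).continuous_fderiv (by norm_num)
  have hsupp : HasCompactSupport fun y => ‖fderiv ℝ (fderiv ℝ w) y‖ := by
    refine HasCompactSupport.intro hc.isCompact fun y hy => ?_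
    have h1 : w =ᶠ[𝓝 y] fun _ => 0 := notMem_tsupport_iff_eventuallyEq.1 hy
    have h2 := h1.fderiv (𝕜 := ℝ)
    rw [h2.fderiv_eq]
    simp only [fderiv_fun_const, Pi.zero_def]
    exact norm_zero (E := Rd d →L[ℝ] Rd d →L[ℝ] ℝ)
  have hn : Continuous fun y => ‖fderiv ℝ (fderiv ℝ w) y‖ :=
    (continuous_norm (E := Rd d →L[ℝ] Rd d →L[ℝ] ℝ)).comp hcont
  obtain ⟨C, hC⟩ := hsupp.exists_bound_of_continuous hn
  refine ⟨C, fun y z => ?_⟩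
  have h1 := (fderiv ℝ (fderiv ℝ w) y).le_opNorm₂ z z
  rw [Real.norm_eq_abs] at h1
  refine h1.trans ?_
  rw [mul_assoc, ← sq]
  refine mul_le_mul_of_nonneg_right ?_ (by positivity)
  exact (le_abs_self _).trans (hC y)

lemma exists_heatStep_bound {w : Rd d → ℝ} (hw : ContDiff ℝ 2 w) (hc : HasCompactSupport w) :
    ∃ C, ∀ h > 0, ∀ y, |(heatStep h w y - w y) / h| ≤ C := by
  obtain ⟨C, hC⟩ := exists_hessian_bound hw hc
  refine ⟨∫ z : Rd d, C * ‖z‖ ^ 2 ∂stdGaussian (Rd d), fun h hh y => ?_⟩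
  rw [heatStep_sub_eq hw hc h, ← Real.norm_eq_abs]
  refine norm_integral_le_of_norm_le (integrable_norm_sq_stdGaussian.const_mul C)
    (Eventually.of_forall fun z => ?_)
  obtain ⟨ξ, -, he⟩ := taylor_quotient hw hh y z
  rw [he]
  exact hC _ _

/-- The generator of `heatStep` is the Laplacian, uniformly along convergent base points. -/
lemma tendsto_heatStep_quotient {w : Rd d → ℝ} (hw : ContDiff ℝ 2 w) (hc : HasCompactSupport w)
    {h : ℕ → ℝ} (hpos : ∀ m, 0 < h m) (hh : Tendsto h atTop (𝓝 0)) {y : ℕ → Rd d} {y₀ : Rd d}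
    (hy : Tendsto y atTop (𝓝 y₀)) :
    Tendsto (fun m => (heatStep (h m) w (y m) - w (y m)) / h m) atTop
      (𝓝 (Laplacian.laplacian w y₀)) := by
  obtain ⟨C, hC⟩ := exists_hessian_bound hw hc
  have hcont : Continuous (fderiv ℝ (fderiv ℝ w)) :=
    (hw.fderiv_right (m := 1) (by norm_num)).continuous_fderiv (by norm_num)
  have hwc := hw.continuous
  rw [laplacian_eq_sum_fderiv, ← integral_bilin_stdGaussian]
  simp_rw [fun m => heatStep_sub_eq hw hc (h m) (y m)]
  refine tendsto_integral_of_dominated_convergence (fun z => C * ‖z‖ ^ 2)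
    (fun m => Continuous.aestronglyMeasurable (by fun_prop))
    (integrable_norm_sq_stdGaussian.const_mul C)
    (fun m => Eventually.of_forall fun z => ?_) (Eventually.of_forall fun z => ?_)
  · obtain ⟨ξ, -, he⟩ := taylor_quotient hw (hpos m) (y m) z
    rw [he]
    exact hC _ _
  · choose ξ hξ he using fun m => taylor_quotient hw (hpos m) (y m) z
    simp_rw [he]
    have h1 : Tendsto (fun m => Real.sqrt (2 * h m)) atTop (𝓝 0) := by
      have := (hh.const_mul 2).sqrt
      simpa using this
    have h2 : Tendsto (fun m => ξ m * Real.sqrt (2 * h m)) atTop (𝓝 0) := by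
      refine squeeze_zero (fun m => mul_nonneg (hξ m).1.le (Real.sqrt_nonneg _)) (fun m => ?_) h1
      exact mul_le_of_le_one_left (Real.sqrt_nonneg _) (hξ m).2.le
    have h3 : Tendsto (fun m => y m + ξ m • Real.sqrt (2 * h m) • z) atTop (𝓝 y₀) := by
      have := hy.add (h2.smul_const z)
      simpa [smul_smul] using this
    have h4 := (hcont.tendsto y₀).comp h3
    have h5 : Continuous fun B : Rd d →L[ℝ] Rd d →L[ℝ] ℝ => B z z := by fun_prop
    exact (h5.tendsto _).comp h4

end Generator

/-! ### Brownian motion sampled along a grid -/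

/-- Brownian motion all of whose paths are continuous and start at `x`. -/
structure IsContinuousBrownianMotion {d : ℕ} {Ω : Type*} [MeasurableSpace Ω] (P : Measure Ω)
    (x : Rd d) (X : ℝ≥0 → Ω → Rd d) : Prop extends IsBrownianMotion P x X where
  start_eq : ∀ ω, X 0 ω = x
  continuous_path : ∀ ω, Continuous fun t => X t ω

section Grid

variable {d : ℕ} {Ω : Type*} [MeasurableSpace Ω] {P : Measure Ω}

/-- Fubini on the product law of `(v, Z)`: on an event determined by `v`, the independent `Z` may be
averaged with `v` frozen. -/
lemma integral_mul_comp_add_of_indepFun [IsProbabilityMeasure P] {V : Type*}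
    [MeasurableSpace V] {v : Ω → V}
    {Z : Ω → Rd d} (hv : Measurable v) (hZ : Measurable Z) (hind : IndepFun v Z P)
    {A : Set V} (hA : MeasurableSet A) {H : V → Rd d} (hH : Measurable H)
    {w : Rd d → ℝ} (hw : Continuous w) {C : ℝ} (hC : ∀ y, |w y| ≤ C) :
    ∫ ω, (v ⁻¹' A).indicator (fun ω => w (H (v ω) + Z ω)) ω ∂P =
      ∫ ω, (v ⁻¹' A).indicator (fun ω => ∫ z, w (H (v ω) + z) ∂(P.map Z)) ω ∂P := by
  have hmap := (indepFun_iff_map_prod_eq_prod_map_map hv.aemeasurable hZ.aemeasurable).1 hind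
  have := Measure.isProbabilityMeasure_map (μ := P) hv.aemeasurable
  have := Measure.isProbabilityMeasure_map (μ := P) hZ.aemeasurable
  let F : V × Rd d → ℝ := fun p => A.indicator (fun a => w (H a + p.2)) p.1
  have hFm : Measurable F := by
    have h1 : F = (Prod.fst ⁻¹' A).indicator fun p => w (H p.1 + p.2) := by
      ext p
      by_cases hp : p.1 ∈ A
      · rw [indicator_of_mem (show p ∈ Prod.fst ⁻¹' A from hp)]; simp [F, hp]
      · rw [indicator_of_notMem (show p ∉ Prod.fst ⁻¹' A from hp)]; simp [F, hp]
    rw [h1]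
    have := hw.measurable
    exact Measurable.indicator (by fun_prop) (hA.preimage measurable_fst)
  have hFb : ∀ p, ‖F p‖ ≤ C := fun p => by
    refine (norm_indicator_le_norm_self _ _).trans ?_
    exact hC _
  have hFi : Integrable F ((P.map v).prod (P.map Z)) :=
    Integrable.of_bound hFm.aestronglyMeasurable C (Eventually.of_forall hFb)
  have e1 : ∫ ω, (v ⁻¹' A).indicator (fun ω => w (H (v ω) + Z ω)) ω ∂P =
      ∫ p, F p ∂((P.map v).prod (P.map Z)) := by
    rw [← hmap, integral_map (by fun_prop) hFm.aestronglyMeasurable]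
    rfl
  rw [e1, integral_prod _ hFi, integral_map hv.aemeasurable]
  · refine integral_congr_ae (Eventually.of_forall fun ω => ?_)
    by_cases h : v ω ∈ A
    · simp [F, h]
    · simp [F, h]
  · exact hFm.stronglyMeasurable.integral_prod_right.aestronglyMeasurable

/-- The event that the process sampled at the times `0, h, …, k h` stays in `K`. -/
def gridStay (X : ℝ≥0 → Ω → Rd d) (K : Set (Rd d)) (h : ℝ≥0) (k : ℕ) : Set Ω :=
  {ω | ∀ j ≤ k, X (j * h) ω ∈ K}

variable {x : Rd d} {X : ℝ≥0 → Ω → Rd d}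

lemma measurableSet_gridStay (hX : IsBrownianMotion P x X) {K : Set (Rd d)}
    (hK : MeasurableSet K) (h : ℝ≥0) (k : ℕ) : MeasurableSet (gridStay X K h k) := by
  have : gridStay X K h k = ⋂ j : ℕ, ⋂ _ : j ≤ k, X (j * h) ⁻¹' K := by
    ext ω; simp [gridStay]
  rw [this]
  exact MeasurableSet.iInter fun j => MeasurableSet.iInter fun _ => hX.measurable _ hK

/-- The Markov property along a grid. -/
lemma integral_gridStay_step [IsProbabilityMeasure P]
    (hX : IsContinuousBrownianMotion P x X) {K : Set (Rd d)}
    (hK : MeasurableSet K) (h : ℝ≥0) (k : ℕ) {w : Rd d → ℝ} (hw : Continuous w) {C : ℝ}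
    (hC : ∀ y, |w y| ≤ C) :
    ∫ ω, (gridStay X K h k).indicator (fun ω => w (X ((k + 1 : ℕ) * h) ω)) ω ∂P =
      ∫ ω, (gridStay X K h k).indicator (fun ω => heatStep h w (X (k * h) ω)) ω ∂P := by
  let t : ℕ → ℝ≥0 := fun i => i * h
  have ht : Monotone t := fun i j hij => by
    simp only [t]; gcongr
  let I : ℕ → Ω → Rd d := fun i ω => X (t (i + 1)) ω - X (t i) ω
  have hIm : ∀ i, Measurable (I i) := fun i => (hX.measurable _).sub (hX.measurable _)
  have hI : iIndepFun I P := hX.indep.nat ht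
  -- The first `k` increments are independent of the next one. The map `Φ j` rebuilds the position
  -- at time `j h` from them, so the event of staying in `K` up to step `k` depends on those
  -- increments alone.
  have hind := (hI.indepFun_finset (Finset.range k) {k} (by simp) hIm).comp measurable_id
    (measurable_pi_apply (⟨k, by simp⟩ : ({k} : Finset ℕ)))
  simp only [Function.comp_def, id] at hind
  let v : Ω → (Finset.range k → Rd d) := fun ω i => I i ω
  let Φ : ℕ → (Finset.range k → Rd d) → Rd d := fun j a =>
    x + ∑ i : Finset.range k, if i.1 < j then a i else 0
  have hv : Measurable v := measurable_pi_lambda _ fun i => hIm _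
  have hΦm : ∀ j, Measurable (Φ j) := fun j => by
    refine measurable_const.add (Finset.measurable_sum _ fun i _ => ?_)
    split_ifs <;> fun_prop
  have hΦ : ∀ j ≤ k, ∀ ω, Φ j (v ω) = X (t j) ω := by
    intro j hj ω
    have h1 : ∑ i : Finset.range k, (if i.1 < j then v ω i else 0) =
        ∑ i ∈ Finset.range k, if i < j then I i ω else 0 :=
      Finset.sum_coe_sort (Finset.range k) fun i => if i < j then I i ω else 0
    have h2 : ∑ i ∈ Finset.range k, (if i < j then I i ω else 0) = ∑ i ∈ Finset.range j, I i ω := by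
      rw [← Finset.sum_filter]
      congr 1
      ext i; simp; omega
    simp only [Φ]
    rw [h1, h2]
    simp only [I]
    rw [Finset.sum_range_sub (fun i => X (t i) ω)]
    simp [t, hX.start_eq]
  have hstay : gridStay X K h k = v ⁻¹' {a | ∀ j ≤ k, Φ j a ∈ K} := by
    ext ω
    simp only [gridStay, mem_preimage, mem_ofPred_eq]
    exact forall₂_congr fun j hj => by rw [hΦ j hj]
  have hA : MeasurableSet {a | ∀ j ≤ k, Φ j a ∈ K} := by
    have : {a | ∀ j ≤ k, Φ j a ∈ K} = ⋂ j : ℕ, ⋂ _ : j ≤ k, Φ j ⁻¹' K := by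
      ext ω; simp
    rw [this]
    exact MeasurableSet.iInter fun j => MeasurableSet.iInter fun _ => hΦm _ hK
  have key := integral_mul_comp_add_of_indepFun hv (hIm k) hind hA (hΦm k) hw hC
  rw [← hstay] at key
  have hlaw := (hX.law (t k) (t (k + 1)) (ht (Nat.le_succ k))).map_eq
  have e1 : (2 * ((t (k + 1) : ℝ) - t k)) = 2 * h := by simp [t]; ring
  rw [e1] at hlaw
  have e2 : ∀ y, ∫ z, w (y + z) ∂(P.map (I k)) = heatStep h w y := by
    intro y
    rw [hlaw, integral_map (by fun_prop) (Continuous.aestronglyMeasurable (by fun_prop))]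
    rfl
  simp_rw [e2, hΦ k le_rfl] at key
  rw [← key]
  congr 1
  ext ω
  congr 1
  ext ω
  simp [I, t]

lemma continuous_heatStep (h : ℝ) {w : Rd d → ℝ} (hw : Continuous w) {C : ℝ}
    (hC : ∀ y, |w y| ≤ C) : Continuous (heatStep h w) := by
  refine continuous_of_dominated (bound := fun _ => C)
    (fun y => Continuous.aestronglyMeasurable (by fun_prop))
    (fun y => Eventually.of_forall fun z => hC _) (integrable_const _)
    (Eventually.of_forall fun z => by fun_prop)

/-- The discounted value at time `k h` on the event that the process has stayed in `K`. -/
def gridValue (P : Measure Ω) (X : ℝ≥0 → Ω → Rd d) (K : Set (Rd d)) (μ : ℝ) (h : ℝ≥0)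
    (w : Rd d → ℝ) (k : ℕ) : ℝ :=
  ∫ ω, (gridStay X K h k).indicator (fun ω => Real.exp (-(μ * (k * h))) * w (X (k * h) ω)) ω ∂P

/-- The discrete generator of the discounted sampled process. -/
def gridGenerator (μ : ℝ) (h : ℝ≥0) (w : Rd d → ℝ) (y : Rd d) : ℝ :=
  (Real.exp (-(μ * h)) * heatStep h w y - w y) / h

/-- Discrete Dynkin formula. One step changes the value by `h` times the discrete generator, up to
the mass lost on paths seen outside `K` for the first time. There `|w| ≤ ε` and the discount is at
most `1`, so each loss is at most `ε` times the probability of leaving at that step, and these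
probabilities telescope. -/
lemma abs_gridValue_sub_sum_le [IsProbabilityMeasure P]
    (hX : IsContinuousBrownianMotion P x X) {K : Set (Rd d)}
    (hK : MeasurableSet K) {h : ℝ≥0} (hh : 0 < h) {μ : ℝ} (hμ : 0 < μ) {w : Rd d → ℝ}
    (hw : Continuous w) {C : ℝ} (hC : ∀ y, |w y| ≤ C) {ε : ℝ} (hε : ∀ y ∉ K, |w y| ≤ ε) (N : ℕ) :
    |gridValue P X K μ h w N - gridValue P X K μ h w 0
      - ∑ k ∈ Finset.range N, h * gridValue P X K μ h (gridGenerator μ h w) k| ≤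
      ε * (P.real (gridStay X K h 0) - P.real (gridStay X K h N)) := by
  have hA := measurableSet_gridStay hX.toIsBrownianMotion hK h
  have hi : ∀ (k : ℕ) (c : ℝ) (j : ℕ) (g : Rd d → ℝ), Continuous g → (∃ C, ∀ y, |g y| ≤ C) →
      Integrable ((gridStay X K h k).indicator (fun ω => c * g (X (j * h) ω))) P := by
    rintro k c j g hg ⟨C', hC'⟩
    refine Integrable.indicator (Integrable.const_mul ?_ c) (hA k)
    exact Integrable.of_bound (hg.measurable.comp (hX.measurable _)).aestronglyMeasurable C'
      (Eventually.of_forall fun ω => hC' _)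
  have hheat : ∀ y, |heatStep h w y| ≤ C := fun y => by
    have := norm_integral_le_of_norm_le_const (μ := stdGaussian (Rd d)) (C := C)
      (f := fun z => w (y + Real.sqrt (2 * h) • z)) (Eventually.of_forall fun z => hC _)
    simpa [heatStep] using this
  induction N with
  | zero => simp
  | succ N ih =>
    have hsub : gridStay X K h (N + 1) ⊆ gridStay X K h N := fun ω hω j hj => hω j (by omega)
    -- The value at step `N + 1` while only staying up to step `N` is required: here the Markov
    -- property gives an exact identity.
    have h1 : ∫ ω, (gridStay X K h N).indicator
        (fun ω => Real.exp (-(μ * ((N + 1 : ℕ) * h))) * w (X ((N + 1 : ℕ) * h) ω)) ω ∂P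
        = gridValue P X K μ h w N + h * gridValue P X K μ h (gridGenerator μ h w) N := by
      have e := integral_gridStay_step hX hK h N hw hC
      have e1 : ∀ (c : ℝ) (F : Ω → ℝ), ∫ ω, (gridStay X K h N).indicator (fun ω => c * F ω) ω ∂P
          = c * ∫ ω, (gridStay X K h N).indicator F ω ∂P := by
        intro c F
        rw [← integral_const_mul]
        congr 1; ext ω
        by_cases hω : ω ∈ gridStay X K h N <;> simp [hω]
      rw [e1, e, gridValue, gridValue, e1, e1]
      have e2 : ∫ ω, (gridStay X K h N).indicator
          (fun ω => gridGenerator μ h w (X (N * h) ω)) ω ∂P = (h : ℝ)⁻¹ * (Real.exp (-(μ * h)) *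
          (∫ ω, (gridStay X K h N).indicator (fun ω => heatStep h w (X (N * h) ω)) ω ∂P)
          - ∫ ω, (gridStay X K h N).indicator (fun ω => w (X (N * h) ω)) ω ∂P) := by
        rw [← integral_const_mul, ← integral_sub, ← integral_const_mul]
        · congr 1; ext ω
          by_cases hω : ω ∈ gridStay X K h N
          · simp [hω, gridGenerator]; ring
          · simp [hω]
        · have := hi N 1 N _ (continuous_heatStep h hw hC) ⟨C, hheat⟩
          simp only [one_mul] at this
          exact this.const_mul _
        · have := hi N 1 N _ hw ⟨C, hC⟩
          simpa only [one_mul] using this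
      rw [e2]
      have hh' : (h : ℝ) ≠ 0 := by exact_mod_cast hh.ne'
      have e3 : Real.exp (-(μ * ((N + 1 : ℕ) * h))) =
          Real.exp (-(μ * (N * h))) * Real.exp (-(μ * h)) := by
        rw [← Real.exp_add]; congr 1; push_cast; ring
      rw [e3]
      field_simp
      ring
    have h2 : |gridValue P X K μ h w (N + 1) - ∫ ω, (gridStay X K h N).indicator
        (fun ω => Real.exp (-(μ * ((N + 1 : ℕ) * h))) * w (X ((N + 1 : ℕ) * h) ω)) ω ∂P| ≤
        ε * (P.real (gridStay X K h N) - P.real (gridStay X K h (N + 1))) := by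
      rw [gridValue, ← integral_sub (hi _ _ _ _ hw ⟨C, hC⟩) (hi _ _ _ _ hw ⟨C, hC⟩),
        ← measureReal_sdiff hsub (hA (N + 1)), mul_comm ε, ← smul_eq_mul (_ : ℝ) ε,
        ← integral_indicator_const ε ((hA N).diff (hA (N + 1))), ← Real.norm_eq_abs]
      refine norm_integral_le_of_norm_le ?_ (Eventually.of_forall fun ω => ?_)
      · exact (integrable_const ε).indicator ((hA N).diff (hA (N + 1)))
      by_cases hω : ω ∈ gridStay X K h (N + 1)
      · have hω' := hsub hω
        simp [hω, hω']
      · by_cases hω' : ω ∈ gridStay X K h N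
        · have hout : X ((N + 1 : ℕ) * h) ω ∉ K := by
            intro hin
            refine hω fun j hj => ?_
            rcases Nat.lt_or_ge N j with hlt | hle
            · obtain rfl : j = N + 1 := by omega
              exact hin
            · exact hω' j hle
          have hb := hε _ hout
          have hexp : Real.exp (-(μ * ((N + 1 : ℕ) * h))) ≤ 1 :=
            Real.exp_le_one_iff.2 (neg_nonpos.2 (by positivity))
          rw [indicator_of_notMem hω, indicator_of_mem hω', 
            indicator_of_mem (show ω ∈ gridStay X K h N \ gridStay X K h (N + 1) from ⟨hω', hω⟩),
            zero_sub,
            norm_neg, norm_mul, Real.norm_eq_abs, Real.norm_eq_abs, abs_of_pos (Real.exp_pos _)]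
          exact (mul_le_of_le_one_left (abs_nonneg _) hexp).trans hb
        · simp [hω, hω']
    rw [Finset.sum_range_succ]
    calc _ = |(gridValue P X K μ h w (N + 1) - ∫ ω, (gridStay X K h N).indicator
        (fun ω => Real.exp (-(μ * ((N + 1 : ℕ) * h))) * w (X ((N + 1 : ℕ) * h) ω)) ω ∂P) +
        (gridValue P X K μ h w N - gridValue P X K μ h w 0
        - ∑ k ∈ Finset.range N, h * gridValue P X K μ h (gridGenerator μ h w) k)| := by
          rw [h1]; congr 1; ring
      _ ≤ _ := (abs_add_le _ _).trans (add_le_add h2 ih)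
      _ = _ := by ring

end Grid

/-- Rewrites the Riemann sum of the discrete formula as an integral over continuous time, so that
dominated convergence applies as the mesh shrinks. -/
lemma integral_floor_step {h : ℝ} (hh : 0 < h) (b : ℕ → ℝ) (N : ℕ) :
    ∫ q in Ioc 0 (N * h), b ⌊q / h⌋₊ = ∑ k ∈ Finset.range N, h * b k := by
  have hcell : ∀ k : ℕ, ∀ q ∈ Ioo (k * h) ((k + 1 : ℕ) * h), b k = b ⌊q / h⌋₊ := by
    intro k q hq
    have : ⌊q / h⌋₊ = k := by
      rw [Nat.floor_eq_iff (div_nonneg ((by positivity : (0 : ℝ) ≤ k * h).trans hq.1.le) hh.le)]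
      constructor
      · rw [le_div_iff₀ hh]; exact hq.1.le
      · rw [div_lt_iff₀ hh]; have := hq.2; push_cast at this; exact this
    rw [this]
  have hle : ∀ k : ℕ, (k : ℝ) * h ≤ (k + 1 : ℕ) * h := fun k => by
    gcongr; exact Nat.le_succ k
  rw [← intervalIntegral.integral_of_le (by positivity)]
  have := intervalIntegral.sum_integral_adjacent_intervals (μ := volume) (f := fun q => b ⌊q / h⌋₊)
    (a := fun k : ℕ => (k : ℝ) * h) (n := N) ?_
  · simp only [Nat.cast_zero, zero_mul] at this
    rw [← this]
    refine Finset.sum_congr rfl fun k _ => ?_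
    rw [intervalIntegral.integral_of_le (hle k), integral_Ioc_eq_integral_Ioo,
      ← setIntegral_congr_fun measurableSet_Ioo (hcell k)]
    simp
    left
    rw [max_eq_left (by nlinarith)]
    ring
  · intro k _
    rw [intervalIntegrable_iff_integrableOn_Ioo_of_le (hle k)]
    exact IntegrableOn.congr_fun (integrableOn_const (by simp)) (hcell k) measurableSet_Ioo

/-! ### Dynkin's formula -/

section Dynkin

variable {d : ℕ} {Ω : Type*}

/-- The event that the process stays in `K` up to time `q`. -/
def stay (X : ℝ≥0 → Ω → Rd d) (K : Set (Rd d)) (q : ℝ≥0) : Set Ω :=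
  {ω | ∀ r ≤ q, X r ω ∈ K}

lemma mem_stay {X : ℝ≥0 → Ω → Rd d} {K : Set (Rd d)} {q : ℝ≥0} {ω : Ω} :
    ω ∈ stay X K q ↔ ∀ r ≤ q, X r ω ∈ K := Iff.rfl

variable [MeasurableSpace Ω] {P : Measure Ω} {x : Rd d} {X : ℝ≥0 → Ω → Rd d}

lemma abs_exp_neg_sub_one_le {a : ℝ} (ha : 0 ≤ a) : |Real.exp (-a) - 1| ≤ a := by
  rw [abs_of_nonpos (by linarith [Real.exp_le_one_iff.2 (neg_nonpos.2 ha)])]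
  linarith [Real.add_one_le_exp (-a)]

lemma gridGenerator_eq (μ : ℝ) (h : ℝ≥0) (w : Rd d → ℝ) (y : Rd d) :
    gridGenerator μ h w y = Real.exp (-(μ * h)) * ((heatStep h w y - w y) / h)
      + (Real.exp (-(μ * h)) - 1) / h * w y := by
  rw [gridGenerator]; ring

lemma exists_gridGenerator_bound {w : Rd d → ℝ} (hw : ContDiff ℝ 2 w) (hc : HasCompactSupport w)
    {μ : ℝ} (hμ : 0 < μ) : ∃ C, ∀ h : ℝ≥0, 0 < h → ∀ y, |gridGenerator μ h w y| ≤ C := by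
  obtain ⟨C₁, h₁⟩ := exists_heatStep_bound hw hc
  obtain ⟨C₂, h₂⟩ := hc.exists_bound_of_continuous hw.continuous
  refine ⟨C₁ + μ * C₂, fun h hh y => ?_⟩
  have hh' : (0 : ℝ) < h := hh
  rw [gridGenerator_eq]
  refine (abs_add_le _ _).trans (add_le_add ?_ ?_)
  · rw [abs_mul, abs_of_pos (Real.exp_pos _)]
    refine (mul_le_of_le_one_left (abs_nonneg _) ?_).trans (h₁ h hh' y)
    exact Real.exp_le_one_iff.2 (neg_nonpos.2 (by positivity))
  · rw [abs_mul, abs_div, abs_of_pos hh']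
    refine mul_le_mul ?_ (h₂ y) (abs_nonneg _) hμ.le
    rw [div_le_iff₀ hh']
    exact abs_exp_neg_sub_one_le (by positivity)

/-- Discounting at rate `μ` adds the derivative `-μ` of `exp (-μ h)` at `h = 0` to the generator
`Δ`. Convergence along moving base points is needed because the path is evaluated at grid times that
approach `q`. -/
lemma tendsto_gridGenerator {w : Rd d → ℝ} (hw : ContDiff ℝ 2 w) (hc : HasCompactSupport w)
    (μ : ℝ) {h : ℕ → ℝ≥0} (hpos : ∀ m, 0 < h m) (hh : Tendsto (fun m => (h m : ℝ)) atTop (𝓝 0))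
    {y : ℕ → Rd d} {y₀ : Rd d} (hy : Tendsto y atTop (𝓝 y₀)) :
    Tendsto (fun m => gridGenerator μ (h m) w (y m)) atTop
      (𝓝 (Laplacian.laplacian w y₀ - μ * w y₀)) := by
  simp_rw [gridGenerator_eq]
  have h1 : Tendsto (fun m => Real.exp (-(μ * h m))) atTop (𝓝 1) := by
    have := (Real.continuous_exp.tendsto _).comp (hh.const_mul μ).neg
    simpa [Function.comp_def] using this
  have h2 : Tendsto (fun m => (Real.exp (-(μ * h m)) - 1) / h m) atTop (𝓝 (-μ)) := by
    have hd : HasDerivAt (fun a : ℝ => Real.exp (-(μ * a))) (-μ) 0 := by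
      have : HasDerivAt (fun a : ℝ => -(μ * a)) (-μ) 0 := by
        convert! ((hasDerivAt_id (0 : ℝ)).const_mul μ).neg using 1
        simp
      simpa using this.exp
    rw [hasDerivAt_iff_tendsto_slope] at hd
    have hh' : Tendsto (fun m => (h m : ℝ)) atTop (𝓝[≠] 0) :=
      tendsto_nhdsWithin_iff.2 ⟨hh, Eventually.of_forall fun m => by
        have : (0 : ℝ) < h m := hpos m
        exact this.ne'⟩
    refine (hd.comp hh').congr fun m => ?_
    simp [slope_def_field]
  have h3 := tendsto_heatStep_quotient hw hc (h := fun m => (h m : ℝ)) (fun m => hpos m) hh hy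
  have h4 := (hw.continuous.tendsto y₀).comp hy
  have := (h1.mul h3).add (h2.mul h4)
  convert! this using 2
  ring

lemma continuous_gridGenerator {w : Rd d → ℝ} (hw : Continuous w) {C : ℝ} (hC : ∀ y, |w y| ≤ C)
    (μ : ℝ) (h : ℝ≥0) : Continuous (gridGenerator μ h w) := by
  have := continuous_heatStep h hw hC
  unfold gridGenerator
  fun_prop

lemma abs_gridValue_le [IsProbabilityMeasure P] {K : Set (Rd d)} (μ : ℝ) (h : ℝ≥0)
    {w : Rd d → ℝ} {C : ℝ} (hC : ∀ y, |w y| ≤ C) (k : ℕ) :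
    |gridValue P X K μ h w k| ≤ Real.exp (-(μ * (k * h))) * C := by
  have := norm_integral_le_of_norm_le_const (μ := P) (C := Real.exp (-(μ * (k * h))) * C)
    (f := (gridStay X K h k).indicator
      (fun ω => Real.exp (-(μ * (k * h))) * w (X (k * h) ω))) (Eventually.of_forall fun ω => ?_)
  · simpa [gridValue] using this
  · refine (norm_indicator_le_norm_self _ _).trans ?_
    rw [norm_mul, Real.norm_eq_abs, Real.norm_eq_abs, abs_of_pos (Real.exp_pos _)]
    exact mul_le_mul_of_nonneg_left (hC _) (Real.exp_nonneg _)

/-- The grid point `⌊q / h⌋ h` converges to `q` as the mesh `h` tends to `0`. -/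
lemma tendsto_floor_mul {h : ℕ → ℝ≥0} (hpos : ∀ m, 0 < h m)
    (hh : Tendsto (fun m => (h m : ℝ)) atTop (𝓝 0)) {q : ℝ} (hq : 0 ≤ q) :
    Tendsto (fun m => (⌊q / h m⌋₊ : ℝ) * h m) atTop (𝓝 q) := by
  have h1 : Tendsto (fun m => q - (h m : ℝ)) atTop (𝓝 q) := by simpa using hh.const_sub q
  refine tendsto_of_tendsto_of_tendsto_of_le_of_le h1 tendsto_const_nhds (fun m => ?_) fun m => ?_
  · have hm : (0 : ℝ) < h m := hpos m
    have := Nat.lt_floor_add_one (q / h m)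
    rw [div_lt_iff₀ hm] at this
    simp only
    linarith
  · have hm : (0 : ℝ) < h m := hpos m
    have := Nat.floor_le (div_nonneg hq hm.le)
    rwa [le_div_iff₀ hm] at this

lemma tendsto_floor_mul_nnreal {h : ℕ → ℝ≥0} (hpos : ∀ m, 0 < h m)
    (hh : Tendsto (fun m => (h m : ℝ)) atTop (𝓝 0)) {q : ℝ} (hq : 0 ≤ q) :
    Tendsto (fun m => (⌊q / h m⌋₊ : ℝ≥0) * h m) atTop (𝓝 q.toNNReal) := by
  have := (continuous_real_toNNReal.tendsto q).comp (tendsto_floor_mul hpos hh hq)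
  refine this.congr fun m => ?_
  rw [Function.comp_apply, ← NNReal.coe_natCast, ← NNReal.coe_mul, Real.toNNReal_coe]

/-- The killing events converge path by path. A path that stays in `K` is seen in `K` at every grid
time. A path outside `K` at some time `r ≤ q` is outside at nearby grid times, since it is
continuous and `K` is closed. -/
lemma tendsto_gridValue [IsProbabilityMeasure P] (hX : IsContinuousBrownianMotion P x X)
    {K : Set (Rd d)} (hK : IsClosed K) {w : Rd d → ℝ} (hw : ContDiff ℝ 2 w)
    (hc : HasCompactSupport w) {μ : ℝ} (hμ : 0 < μ) {h : ℕ → ℝ≥0} (hpos : ∀ m, 0 < h m)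
    (hh : Tendsto (fun m => (h m : ℝ)) atTop (𝓝 0)) {q : ℝ} (hq : 0 < q) :
    Tendsto (fun m => gridValue P X K μ (h m) (gridGenerator μ (h m) w) ⌊q / h m⌋₊) atTop
      (𝓝 (-(Real.exp (-(μ * q)) * ∫ ω, (stay X K q.toNNReal).indicator (fun ω =>
        μ * w (X q.toNNReal ω) - Laplacian.laplacian w (X q.toNNReal ω)) ω ∂P))) := by
  obtain ⟨C, hC⟩ := exists_gridGenerator_bound hw hc hμ
  obtain ⟨C₂, hC₂⟩ := hc.exists_bound_of_continuous hw.continuous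
  have hlim := tendsto_floor_mul hpos hh hq.le
  have hexp : Tendsto (fun m => Real.exp (-(μ * (⌊q / h m⌋₊ * h m)))) atTop
      (𝓝 (Real.exp (-(μ * q)))) := (Real.continuous_exp.tendsto _).comp (hlim.const_mul μ).neg
  rw [← integral_const_mul, ← integral_neg]
  refine tendsto_integral_of_dominated_convergence (fun _ => C) (fun m => ?_) (integrable_const C)
    (fun m => Eventually.of_forall fun ω => ?_) (Eventually.of_forall fun ω => ?_)
  · refine AEStronglyMeasurable.indicator ?_
      (measurableSet_gridStay hX.toIsBrownianMotion hK.measurableSet _ _)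
    have h1 := (continuous_gridGenerator hw.continuous hC₂ μ (h m)).measurable.comp
      (hX.measurable (⌊q / h m⌋₊ * h m))
    exact (h1.const_mul _).aestronglyMeasurable
  · refine (norm_indicator_le_norm_self _ _).trans ?_
    rw [norm_mul, Real.norm_eq_abs, Real.norm_eq_abs, abs_of_pos (Real.exp_pos _)]
    refine (mul_le_of_le_one_left (abs_nonneg _) ?_).trans (hC _ (hpos m) _)
    exact Real.exp_le_one_iff.2 (neg_nonpos.2 (by positivity))
  · by_cases hω : ω ∈ stay X K q.toNNReal
    · rw [indicator_of_mem hω]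
      have h1 : ∀ m, ω ∈ gridStay X K (h m) ⌊q / h m⌋₊ := fun m j hj => by
        refine hω _ ?_
        rw [Nat.le_floor_iff (div_nonneg hq.le (NNReal.coe_nonneg _)),
          le_div_iff₀ (NNReal.coe_pos.2 (hpos m))] at hj
        rw [Real.le_toNNReal_iff_coe_le hq.le]
        push_cast
        exact hj
      simp only [indicator_of_mem (h1 _)]
      have h2 := ((hX.continuous_path ω).tendsto _).comp (tendsto_floor_mul_nnreal hpos hh hq.le)
      have h3 := hexp.mul (tendsto_gridGenerator hw hc μ hpos hh h2)
      convert! h3 using 2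
      ring
    · rw [indicator_of_notMem hω]
      simp only [mem_stay, not_forall] at hω
      obtain ⟨r, hr, hrK⟩ := hω
      have h2 := ((hX.continuous_path ω).tendsto _).comp
        (tendsto_floor_mul_nnreal hpos hh (NNReal.coe_nonneg r))
      rw [Real.toNNReal_coe] at h2
      have h3 := h2.eventually (hK.isOpen_compl.mem_nhds hrK)
      refine Tendsto.congr' (f₁ := fun _ => 0) ?_ (by simp)
      filter_upwards [h3] with m hm
      rw [indicator_of_notMem]
      intro hcon
      refine hm (hcon _ (Nat.floor_mono ?_))
      have : (r : ℝ) ≤ q := (Real.le_toNNReal_iff_coe_le hq.le).1 hr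
      gcongr

/-- Dynkin's formula for a compactly supported function which is small off the closed set `K`. -/
lemma abs_sub_integral_stay_le [IsProbabilityMeasure P] (hX : IsContinuousBrownianMotion P x X)
    {K : Set (Rd d)} (hK : IsClosed K) (hxK : x ∈ K) {w : Rd d → ℝ} (hw : ContDiff ℝ 2 w)
    (hc : HasCompactSupport w) {μ : ℝ} (hμ : 0 < μ) {ε : ℝ} (hε0 : 0 ≤ ε)
    (hε : ∀ y ∉ K, |w y| ≤ ε) :
    |w x - ∫ q in Ioi (0 : ℝ), Real.exp (-(μ * q)) * ∫ ω, (stay X K q.toNNReal).indicator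
      (fun ω => μ * w (X q.toNNReal ω) - Laplacian.laplacian w (X q.toNNReal ω)) ω ∂P| ≤ ε := by
  obtain ⟨C, hC⟩ := exists_gridGenerator_bound hw hc hμ
  obtain ⟨C₂, hC₂⟩ := hc.exists_bound_of_continuous hw.continuous
  -- Mesh `1 / (m + 1)` with `(m + 1) ^ 2` steps gives the horizon `m + 1`: the mesh vanishes while
  -- the horizon grows, and the discount kills the terminal value.
  let h : ℕ → ℝ≥0 := fun m => 1 / (m + 1)
  have hcoe : ∀ m, (h m : ℝ) = 1 / ((m : ℝ) + 1) := fun m => by simp [h]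
  have hpos : ∀ m, 0 < h m := fun m => by simp only [h]; positivity
  have hle1 : ∀ m, (h m : ℝ) ≤ 1 := fun m => by
    rw [hcoe, div_le_one (by positivity)]; linarith [(m.cast_nonneg : (0 : ℝ) ≤ m)]
  have hh : Tendsto (fun m => (h m : ℝ)) atTop (𝓝 0) := by
    simp_rw [hcoe]; exact tendsto_one_div_add_atTop_nhds_zero_nat
  let N : ℕ → ℕ := fun m => (m + 1) ^ 2
  have hN : ∀ m, (N m : ℝ) * h m = m + 1 := fun m => by
    rw [hcoe]; simp only [N]; push_cast; field_simp
  let b : ℕ → ℕ → ℝ := fun m k => gridValue P X K μ (h m) (gridGenerator μ (h m) w) k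
  let c : ℝ → ℝ := fun q => Real.exp (-(μ * q)) * ∫ ω, (stay X K q.toNNReal).indicator
      (fun ω => μ * w (X q.toNNReal ω) - Laplacian.laplacian w (X q.toNNReal ω)) ω ∂P
  have hmain : ∀ m, |gridValue P X K μ (h m) w (N m) - w x
      - ∑ k ∈ Finset.range (N m), h m * b m k| ≤ ε := by
    intro m
    have h1 := abs_gridValue_sub_sum_le hX hK.measurableSet (hpos m) hμ hw.continuous hC₂ hε (N m)
    have h0 : gridValue P X K μ (h m) w 0 = w x := by
      have : ∀ ω, ω ∈ gridStay X K (h m) 0 := fun ω j hj => by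
        obtain rfl : j = 0 := by omega
        simpa [hX.start_eq] using hxK
      simp [gridValue, indicator_of_mem (this _), hX.start_eq]
    rw [h0] at h1
    refine h1.trans (mul_le_of_le_one_right hε0 ?_)
    have h2 : P.real (gridStay X K (h m) 0) ≤ 1 := measureReal_le_one
    linarith [measureReal_nonneg (μ := P) (s := gridStay X K (h m) (N m))]
  have hsum : Tendsto (fun m => ∑ k ∈ Finset.range (N m), h m * b m k) atTop
      (𝓝 (∫ q in Ioi (0 : ℝ), -c q)) := by
    have e : ∀ m, ∑ k ∈ Finset.range (N m), h m * b m k =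
        ∫ q in Ioi (0 : ℝ), (Iic ((m : ℝ) + 1)).indicator (fun q => b m ⌊q / h m⌋₊) q := by
      intro m
      rw [← integral_floor_step (NNReal.coe_pos.2 (hpos m)) (b m) (N m), hN,
        integral_indicator measurableSet_Iic,
        Measure.restrict_restrict measurableSet_Iic, inter_comm, Ioi_inter_Iic]
    simp_rw [e]
    -- As the mesh is at most `1`, the grid time below `q` is at least `q - 1`. This shift costs the
    -- factor `exp μ` in the dominating function.
    refine tendsto_integral_of_dominated_convergence
      (fun q => Real.exp μ * C * μ⁻¹ * (μ * Real.exp (-(μ * q)))) (fun m => ?_)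
      ((integrableOn_exp_density hμ 0).const_mul _) (fun m => ?_) ?_
    · refine (Measurable.indicator ?_ measurableSet_Iic).aestronglyMeasurable
      exact (measurable_from_nat (f := b m)).comp
        (Nat.measurable_floor.comp (measurable_id.div_const _))
    · filter_upwards [ae_restrict_mem measurableSet_Ioi] with q hq
      refine (norm_indicator_le_norm_self _ _).trans ?_
      have hC0 : 0 ≤ C := (abs_nonneg _).trans (hC 1 one_pos 0)
      refine (abs_gridValue_le μ (h m) (hC (h m) (hpos m)) _).trans ?_
      have h1 : q - 1 ≤ (⌊q / h m⌋₊ : ℝ) * h m := by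
        have hm : (0 : ℝ) < h m := hpos m
        have := Nat.lt_floor_add_one (q / h m)
        rw [div_lt_iff₀ hm] at this
        linarith [hle1 m]
      calc Real.exp (-(μ * (⌊q / h m⌋₊ * h m))) * C ≤ Real.exp (-(μ * (q - 1))) * C := by gcongr
        _ = Real.exp μ * C * μ⁻¹ * (μ * Real.exp (-(μ * q))) := by
          rw [show -(μ * (q - 1)) = μ + -(μ * q) by ring, Real.exp_add]
          field_simp
    · filter_upwards [ae_restrict_mem measurableSet_Ioi] with q hq
      refine (tendsto_gridValue hX hK hw hc hμ hpos hh hq).congr' ?_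
      filter_upwards [eventually_ge_atTop ⌈q⌉₊] with m hm
      rw [indicator_of_mem]
      have := Nat.ceil_le.1 hm
      simp only [mem_Iic]
      linarith
  have hlast : Tendsto (fun m => gridValue P X K μ (h m) w (N m)) atTop (𝓝 0) := by
    have h1 : Tendsto (fun m : ℕ => Real.exp (-(μ * ((m : ℝ) + 1))) * C₂) atTop (𝓝 0) := by
      have : Tendsto (fun m : ℕ => μ * ((m : ℝ) + 1)) atTop atTop :=
        (tendsto_atTop_add_const_right _ _ tendsto_natCast_atTop_atTop).const_mul_atTop hμ
      simpa using (Real.tendsto_exp_neg_atTop_nhds_zero.comp this).mul_const C₂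
    refine squeeze_zero_norm (fun m => ?_) h1
    have := abs_gridValue_le (P := P) (X := X) (K := K) μ (h m) hC₂ (N m)
    rwa [hN] at this
  have hall := ((hlast.sub_const (w x)).sub hsum).abs
  have := le_of_tendsto' hall hmain
  rw [integral_neg] at this
  rw [abs_sub_comm]
  convert! this using 2
  simp only [c]
  ring

end Dynkin

/-! ### The killed process at an exponential time -/

section Killed

variable {d : ℕ} {Ω : Type*}

/-- The points of `D` at distance at least `1 / (n + 1)` from the complement of `D`. -/
def core (D : Set (Rd d)) (n : ℕ) : Set (Rd d) :=
  {y | 1 / ((n : ℝ) + 1) ≤ Metric.infDist y Dᶜ}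

lemma isClosed_core (D : Set (Rd d)) (n : ℕ) : IsClosed (core D n) :=
  isClosed_le continuous_const (Metric.continuous_infDist_pt _)

lemma core_subset (D : Set (Rd d)) (n : ℕ) : core D n ⊆ D := by
  intro y hy
  by_contra h
  have h1 : 1 / ((n : ℝ) + 1) ≤ Metric.infDist y Dᶜ := hy
  rw [Metric.infDist_zero_of_mem (s := Dᶜ) h] at h1
  have : 0 < 1 / ((n : ℝ) + 1) := by positivity
  linarith

lemma one_div_lt_of_lt {m n : ℕ} (h : m < n) : 1 / ((n : ℝ) + 1) < 1 / ((m : ℝ) + 1) := by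
  have : (m : ℝ) < n := by exact_mod_cast h
  exact one_div_lt_one_div_of_lt (by positivity) (by linarith)

lemma core_mono (D : Set (Rd d)) : Monotone (core D) := by
  intro m n hmn y hy
  rcases hmn.eq_or_lt with rfl | h
  · exact hy
  · exact (one_div_lt_of_lt h).le.trans hy

lemma core_subset_interior (D : Set (Rd d)) (n : ℕ) : core D n ⊆ interior (core D (n + 1)) := by
  have hopen : IsOpen {y : Rd d | 1 / (((n + 1 : ℕ) : ℝ) + 1) < Metric.infDist y Dᶜ} :=
    isOpen_lt continuous_const (Metric.continuous_infDist_pt _)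
  refine Subset.trans ?_ (interior_maximal (fun y hy => ?_) hopen)
  · exact fun y hy => (one_div_lt_of_lt (Nat.lt_succ_self n)).trans_le hy
  · exact le_of_lt (show 1 / (((n + 1 : ℕ) : ℝ) + 1) < Metric.infDist y Dᶜ from hy)

/-- A compact subset of the open set `D` is contained in one of the sets `core D n`. -/
lemma exists_subset_core {D : Set (Rd d)} (hD : IsOpen D) (hne : Dᶜ.Nonempty) {A : Set (Rd d)}
    (hA : IsCompact A) (hAD : A ⊆ D) : ∃ n, A ⊆ core D n := by
  rcases A.eq_empty_or_nonempty with rfl | hAne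
  · exact ⟨0, empty_subset _⟩
  obtain ⟨y, hy, hmin⟩ := hA.exists_isMinOn hAne (Metric.continuous_infDist_pt Dᶜ).continuousOn
  have hpos : 0 < Metric.infDist y Dᶜ :=
    (hD.isClosed_compl.notMem_iff_infDist_pos hne).1 (fun h => h (hAD hy))
  obtain ⟨n, hn⟩ := exists_nat_one_div_lt hpos
  exact ⟨n, fun z hz => hn.le.trans (hmin hz)⟩

lemma isCompact_core {D : Set (Rd d)} (hD : Bornology.IsBounded D) (n : ℕ) :
    IsCompact (core D n) :=
  Metric.isCompact_of_isClosed_isBounded (isClosed_core D n) (hD.subset (core_subset D n))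

/-- The path on `[0, q]` has compact image, so if it lies in `D` it keeps a positive distance from
the complement. -/
lemma stay_eq_iUnion_core {X : ℝ≥0 → Ω → Rd d} (hc : ∀ ω, Continuous fun t => X t ω)
    {D : Set (Rd d)} (hD : IsOpen D) (hne : Dᶜ.Nonempty) (q : ℝ≥0) :
    stay X D q = ⋃ n, stay X (core D n) q := by
  ext ω
  rw [mem_iUnion]
  constructor
  · intro h
    have hcomp : IsCompact ((fun t => X t ω) '' Icc 0 q) := isCompact_Icc.image (hc ω)
    obtain ⟨n, hn⟩ := exists_subset_core hD hne hcomp (by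
      rintro _ ⟨r, hr, rfl⟩
      exact h r hr.2)
    exact ⟨n, fun r hr => hn ⟨r, ⟨zero_le, hr⟩, rfl⟩⟩
  · rintro ⟨n, hn⟩ r hr
    exact core_subset D n (hn r hr)

/-- The pairs `(q, ω)` such that the path `ω` stays in `K` up to time `q`. -/
def staySet (X : ℝ≥0 → Ω → Rd d) (K : Set (Rd d)) : Set (ℝ≥0 × Ω) :=
  {p | p.2 ∈ stay X K p.1}

lemma staySet_eq_iUnion_core {X : ℝ≥0 → Ω → Rd d} (hc : ∀ ω, Continuous fun t => X t ω)
    {D : Set (Rd d)} (hD : IsOpen D) (hne : Dᶜ.Nonempty) :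
    staySet X D = ⋃ n, staySet X (core D n) := by
  ext p
  have := Set.ext_iff.1 (stay_eq_iUnion_core hc hD hne p.1) p.2
  simpa [staySet] using this

variable [MeasurableSpace Ω]

lemma measurable_uncurry_process {X : ℝ≥0 → Ω → Rd d} (hm : ∀ t, Measurable (X t))
    (hc : ∀ ω, Continuous fun t => X t ω) : Measurable fun p : ℝ≥0 × Ω => X p.1 p.2 :=
  measurable_uncurry_of_continuous_of_measurable hc hm

/-- The times `min 1 s * q` parametrise `[0, q]` by a range of `s` independent of `q`. By continuity
and closedness it suffices to test countably many dense `s`, which exhibits the set as a countable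
intersection. -/
lemma measurableSet_staySet_of_isClosed {X : ℝ≥0 → Ω → Rd d} (hm : ∀ t, Measurable (X t))
    (hc : ∀ ω, Continuous fun t => X t ω) {K : Set (Rd d)} (hK : IsClosed K) :
    MeasurableSet (staySet X K) := by
  have hX := measurable_uncurry_process hm hc
  have : staySet X K = ⋂ n : ℕ, {p : ℝ≥0 × Ω |
      X (min 1 (TopologicalSpace.denseSeq ℝ≥0 n) * p.1) p.2 ∈ K} := by
    ext ⟨q, ω⟩
    rw [mem_iInter]
    constructor
    · intro h n
      exact h _ (mul_le_of_le_one_left zero_le (min_le_left _ _))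
    · intro h
      have hcl : IsClosed ((fun s : ℝ≥0 => X (min 1 s * q) ω) ⁻¹' K) :=
        hK.preimage ((hc ω).comp (by fun_prop))
      have huniv : (fun s : ℝ≥0 => X (min 1 s * q) ω) ⁻¹' K = univ := by
        rw [← hcl.closure_eq]
        refine ((TopologicalSpace.denseRange_denseSeq ℝ≥0).mono ?_).closure_eq
        rintro _ ⟨n, rfl⟩
        exact h n
      intro r hr
      rcases eq_or_ne q 0 with rfl | hq
      · have : (1 : ℝ≥0) ∈ (fun s : ℝ≥0 => X (min 1 s * 0) ω) ⁻¹' K := huniv ▸ mem_univ _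
        obtain rfl : r = 0 := le_antisymm hr zero_le
        simpa using this
      · have : r / q ∈ (fun s : ℝ≥0 => X (min 1 s * q) ω) ⁻¹' K := huniv ▸ mem_univ _
        have h1 : r / q ≤ 1 := div_le_one_of_le₀ hr zero_le
        simpa [min_eq_right h1, div_mul_cancel₀ r hq] using this
  rw [this]
  refine MeasurableSet.iInter fun n => ?_
  have h1 : Measurable fun p : ℝ≥0 × Ω =>
      X (min 1 (TopologicalSpace.denseSeq ℝ≥0 n) * p.1) p.2 :=
    hX.comp ((measurable_fst.const_mul _).prodMk measurable_snd)
  exact h1 hK.measurableSet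

lemma measurableSet_staySet_of_isOpen {X : ℝ≥0 → Ω → Rd d} (hm : ∀ t, Measurable (X t))
    (hc : ∀ ω, Continuous fun t => X t ω) {D : Set (Rd d)} (hD : IsOpen D)
    (hne : Dᶜ.Nonempty) : MeasurableSet (staySet X D) := by
  rw [staySet_eq_iUnion_core hc hD hne]
  exact MeasurableSet.iUnion fun n => measurableSet_staySet_of_isClosed hm hc (isClosed_core D n)

/-- The law at an independent exponential time of rate `μ` of the process killed when it
leaves `K`. -/
def killedLaw (P : Measure Ω) (X : ℝ≥0 → Ω → Rd d) (K : Set (Rd d)) (μ : ℝ) : Measure (Rd d) :=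
  ((((expTime μ).map Real.toNNReal).prod P).restrict (staySet X K)).map fun p => X p.1 p.2

variable {P : Measure Ω} {X : ℝ≥0 → Ω → Rd d} {K : Set (Rd d)} {μ : ℝ}

lemma isProbabilityMeasure_map_expTime (hμ : 0 < μ) :
    IsProbabilityMeasure ((expTime μ).map Real.toNNReal) := by
  have := isProbabilityMeasure_expTime hμ
  exact Measure.isProbabilityMeasure_map measurable_real_toNNReal.aemeasurable

lemma isFiniteMeasure_killedLaw [IsProbabilityMeasure P] (hμ : 0 < μ) :
    IsFiniteMeasure (killedLaw P X K μ) := by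
  have := isProbabilityMeasure_map_expTime hμ
  unfold killedLaw
  infer_instance

lemma ae_killedLaw_mem (hm : ∀ t, Measurable (X t)) (hc : ∀ ω, Continuous fun t => X t ω)
    (hS : MeasurableSet (staySet X K)) (hK : MeasurableSet K) :
    ∀ᵐ y ∂killedLaw P X K μ, y ∈ K := by
  refine (ae_map_iff (p := fun y => y ∈ K)
    (measurable_uncurry_process hm hc).aemeasurable hK).2 ?_
  filter_upwards [ae_restrict_mem hS] with p hp
  exact hp p.1 le_rfl

/-- The killed law charges only `K`, so regularity of `G` on `K` is enough. This admits functions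
such as `Δu(t, ·)`, which are controlled only inside `D`. -/
lemma aestronglyMeasurable_killedLaw (hm : ∀ t, Measurable (X t))
    (hc : ∀ ω, Continuous fun t => X t ω) (hS : MeasurableSet (staySet X K))
    (hK : MeasurableSet K) {G : Rd d → ℝ} (hG : ContinuousOn G K) :
    AEStronglyMeasurable G (killedLaw P X K μ) := by
  have h1 : (killedLaw P X K μ).restrict K = killedLaw P X K μ :=
    Measure.restrict_eq_self_of_ae_mem (ae_killedLaw_mem hm hc hS hK)
  rw [← h1]
  exact hG.aestronglyMeasurable hK

lemma integrable_killedLaw [IsProbabilityMeasure P] (hμ : 0 < μ) (hm : ∀ t, Measurable (X t))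
    (hc : ∀ ω, Continuous fun t => X t ω) (hS : MeasurableSet (staySet X K))
    (hK : MeasurableSet K) {G : Rd d → ℝ} (hG : ContinuousOn G K) {C : ℝ}
    (hC : ∀ y ∈ K, |G y| ≤ C) : Integrable G (killedLaw P X K μ) := by
  have := isFiniteMeasure_killedLaw (P := P) (X := X) (K := K) hμ
  refine Integrable.of_bound (aestronglyMeasurable_killedLaw hm hc hS hK hG) C ?_
  filter_upwards [ae_killedLaw_mem hm hc hS hK] with y hy using hC y hy

lemma integral_killedLaw_eq_setIntegral (hm : ∀ t, Measurable (X t))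
    (hc : ∀ ω, Continuous fun t => X t ω) (hS : MeasurableSet (staySet X K))
    (hK : MeasurableSet K) {G : Rd d → ℝ} (hG : ContinuousOn G K) :
    ∫ y, G y ∂killedLaw P X K μ =
      ∫ p in staySet X K, G (X p.1 p.2) ∂(((expTime μ).map Real.toNNReal).prod P) :=
  integral_map (measurable_uncurry_process hm hc).aemeasurable
    (aestronglyMeasurable_killedLaw hm hc hS hK hG)

lemma integrableOn_staySet [IsProbabilityMeasure P] (hμ : 0 < μ) (hm : ∀ t, Measurable (X t))
    (hc : ∀ ω, Continuous fun t => X t ω) (hS : MeasurableSet (staySet X K))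
    (hK : MeasurableSet K) {G : Rd d → ℝ} (hG : ContinuousOn G K) {C : ℝ}
    (hC : ∀ y ∈ K, |G y| ≤ C) :
    IntegrableOn (fun p => G (X p.1 p.2)) (staySet X K)
      (((expTime μ).map Real.toNNReal).prod P) := by
  have h := integrable_killedLaw (P := P) hμ hm hc hS hK hG hC
  rw [killedLaw, integrable_map_measure (aestronglyMeasurable_killedLaw hm hc hS hK hG)
    (measurable_uncurry_process hm hc).aemeasurable] at h
  exact h

lemma integral_killedLaw [IsProbabilityMeasure P] (hμ : 0 < μ) (hm : ∀ t, Measurable (X t))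
    (hc : ∀ ω, Continuous fun t => X t ω) (hS : MeasurableSet (staySet X K))
    (hK : MeasurableSet K) {G : Rd d → ℝ} (hG : ContinuousOn G K) {C : ℝ}
    (hC : ∀ y ∈ K, |G y| ≤ C) :
    ∫ y, G y ∂killedLaw P X K μ = ∫ q, ∫ ω, (stay X K q).indicator
      (fun ω => G (X q ω)) ω ∂P ∂((expTime μ).map Real.toNNReal) := by
  have := isProbabilityMeasure_map_expTime hμ
  have hI := integrableOn_staySet (P := P) hμ hm hc hS hK hG hC
  rw [integral_killedLaw_eq_setIntegral hm hc hS hK hG, ← integral_indicator hS,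
    integral_prod _ ((integrable_indicator_iff hS).2 hI)]
  rfl

/-- Translates the time integral in Dynkin's formula into the killed law. The density `μ exp (-μ q)`
carries a factor `μ`, whence `μ⁻¹`. -/
lemma integral_exp_mul_eq_killedLaw [IsProbabilityMeasure P] (hμ : 0 < μ)
    (hm : ∀ t, Measurable (X t))
    (hc : ∀ ω, Continuous fun t => X t ω) (hS : MeasurableSet (staySet X K))
    (hK : MeasurableSet K) {G : Rd d → ℝ} (hG : ContinuousOn G K) {C : ℝ}
    (hC : ∀ y ∈ K, |G y| ≤ C) :
    ∫ q in Ioi (0 : ℝ), Real.exp (-(μ * q)) * ∫ ω, (stay X K q.toNNReal).indicator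
      (fun ω => G (X q.toNNReal ω)) ω ∂P = μ⁻¹ * ∫ y, G y ∂killedLaw P X K μ := by
  have := isProbabilityMeasure_map_expTime hμ
  have hI := integrableOn_staySet (P := P) hμ hm hc hS hK hG hC
  have hI' := ((integrable_indicator_iff hS).2 hI).integral_prod_left.aestronglyMeasurable
  rw [integral_killedLaw hμ hm hc hS hK hG hC,
    integral_map measurable_real_toNNReal.aemeasurable (by exact hI'),
    integral_expTime hμ, ← integral_const_mul]
  refine integral_congr_ae (Eventually.of_forall fun q => ?_)
  simp only
  field_simp

end Killed

/-! ### Dynkin's formula on `D` and the Laplace transform of the solution. -/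

section Representation

variable {d : ℕ} {Ω : Type*} [MeasurableSpace Ω] {P : Measure Ω} [IsProbabilityMeasure P]
  {x : Rd d} {X : ℝ≥0 → Ω → Rd d} {D : Set (Rd d)}

/-- Multiplication by a cutoff function turns a `C²` function on `D` into a compactly supported
`C²` function without changing it near `core D n`. -/
lemma exists_cutoff (hDo : IsOpen D) (hDb : Bornology.IsBounded D) {w : Rd d → ℝ}
    (hw : ContDiffOn ℝ 2 w D) (n : ℕ) :
    ∃ w' : Rd d → ℝ, ContDiff ℝ 2 w' ∧ HasCompactSupport w' ∧ (∀ y ∈ D, |w' y| ≤ |w y|) ∧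
      (∀ y ∉ D, w' y = 0) ∧ ∀ y ∈ core D n, w' =ᶠ[𝓝 y] w := by
  obtain ⟨χ, h1, h0, h01⟩ := exists_contMDiffMap_one_nhds_of_subset_interior
    (modelWithCornersSelf ℝ (Rd d)) (n := 2) (isClosed_core D n) (core_subset_interior D n)
  have hχ : ContDiff ℝ 2 χ := χ.contMDiff.contDiff
  have hsupp : tsupport (fun y => χ y * w y) ⊆ core D (n + 1) := by
    refine closure_minimal (fun y hy => ?_) (isClosed_core D _)
    by_contra hcon
    exact hy (by simp [h0 y hcon])
  refine ⟨fun y => χ y * w y, ?_, ?_, fun y _ => ?_, fun y hy => ?_, fun y hy => ?_⟩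
  · rw [contDiff_iff_contDiffAt]
    intro y
    by_cases hy : y ∈ D
    · exact hχ.contDiffAt.mul (hw.contDiffAt (hDo.mem_nhds hy))
    · have : (fun y => χ y * w y) =ᶠ[𝓝 y] fun _ => 0 :=
        notMem_tsupport_iff_eventuallyEq.1 fun h => hy (core_subset D _ (hsupp h))
      exact contDiffAt_const.congr_of_eventuallyEq this
  · exact HasCompactSupport.of_support_subset_isCompact (isCompact_core hDb (n + 1))
      (subset_closure.trans hsupp)
  · rw [abs_mul, abs_of_nonneg (h01 y).1]
    exact mul_le_of_le_one_left (abs_nonneg _) (h01 y).2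
  · have : y ∉ core D (n + 1) := fun h => hy (core_subset D _ h)
    simp [h0 y this]
  · filter_upwards [mem_nhdsSet_iff_forall.1 h1 y hy] with z hz
    have hz : χ z = 1 := hz
    simp [hz]

/-- A continuous function on the closure of `D` which vanishes on the boundary is small outside
`core D n` for large `n`. -/
lemma exists_abs_le_off_core (hDo : IsOpen D) (hDb : Bornology.IsBounded D) (hne : Dᶜ.Nonempty)
    {w : Rd d → ℝ} (hwc : ContinuousOn w (closure D)) (hw0 : ∀ y ∈ frontier D, w y = 0)
    {ε : ℝ} (hε : 0 < ε) : ∃ n, ∀ y ∈ D, y ∉ core D n → |w y| ≤ ε := by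
  have hcl : IsCompact (closure D) := hDb.isCompact_closure
  -- The set where `|w| ≥ ε` is compact in the closure and misses the boundary, where `w = 0`. It is
  -- therefore a compact subset of `D` and lies in some core.
  have hA : IsCompact (closure D ∩ (fun y => |w y|) ⁻¹' Ici ε) :=
    hcl.of_isClosed_subset (hwc.abs.preimage_isClosed_of_isClosed isClosed_closure isClosed_Ici)
      inter_subset_left
  have hAD : closure D ∩ (fun y => |w y|) ⁻¹' Ici ε ⊆ D := by
    rintro y ⟨hy, hyε⟩
    by_contra hyD
    have hyε : ε ≤ |w y| := hyε
    rw [hw0 y ⟨hy, by rwa [hDo.interior_eq]⟩, abs_zero] at hyε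
    linarith
  obtain ⟨n, hn⟩ := exists_subset_core hDo hne hA hAD
  refine ⟨n, fun y hyD hy => ?_⟩
  by_contra hcon
  exact hy (hn ⟨subset_closure hyD, (not_le.1 hcon).le⟩)

/-- Dynkin's formula for the process killed on leaving `D`, at an exponential time. -/
theorem eq_integral_killedLaw (hX : IsContinuousBrownianMotion P x X) (hDo : IsOpen D)
    (hDb : Bornology.IsBounded D) (hne : Dᶜ.Nonempty) (hx : x ∈ D) {w : Rd d → ℝ}
    (hw : ContDiffOn ℝ 2 w D) (hwc : ContinuousOn w (closure D))
    (hw0 : ∀ y ∈ frontier D, w y = 0) (hΔ : ContinuousOn (Laplacian.laplacian w) D) {M L : ℝ}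
    (hM : ∀ y ∈ D, |w y| ≤ M) (hL : ∀ y ∈ D, |Laplacian.laplacian w y| ≤ L)
    {μ : ℝ} (hμ : 0 < μ) :
    w x = μ⁻¹ * ∫ y, (μ * w y - Laplacian.laplacian w y) ∂killedLaw P X D μ := by
  have hm := hX.measurable
  have hc := hX.continuous_path
  have hSn := fun n => measurableSet_staySet_of_isClosed hm hc (isClosed_core D n)
  have hS := measurableSet_staySet_of_isOpen hm hc hDo hne
  let G : Rd d → ℝ := fun y => μ * w y - Laplacian.laplacian w y
  have hG : ContinuousOn G D := (continuousOn_const.mul (hwc.mono subset_closure)).sub hΔ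
  have hGC : ∀ y ∈ D, |G y| ≤ μ * M + L := fun y hy => by
    refine (abs_sub _ _).trans (add_le_add ?_ (hL y hy))
    rw [abs_mul, abs_of_pos hμ]
    exact mul_le_mul_of_nonneg_left (hM y hy) hμ.le
  have hlim : Tendsto (fun n => μ⁻¹ * ∫ y, G y ∂killedLaw P X (core D n) μ) atTop
      (𝓝 (μ⁻¹ * ∫ y, G y ∂killedLaw P X D μ)) := by
    refine Tendsto.const_mul _ ?_
    rw [integral_killedLaw_eq_setIntegral hm hc hS hDo.measurableSet hG,
      staySet_eq_iUnion_core hc hDo hne]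
    simp_rw [fun n => integral_killedLaw_eq_setIntegral (P := P) (μ := μ) hm hc (hSn n)
      (isClosed_core D n).measurableSet (hG.mono (core_subset D n))]
    refine tendsto_setIntegral_of_monotone hSn ?_ ?_
    · intro i j hij p hp r hr
      exact core_mono D hij (hp r hr)
    · rw [← staySet_eq_iUnion_core hc hDo hne]
      exact integrableOn_staySet hμ hm hc hS hDo.measurableSet hG hGC
  obtain ⟨n₀, hn₀⟩ := exists_subset_core hDo hne (isCompact_singleton (x := x))
    (singleton_subset_iff.2 hx)
  -- For large `n`, the point `x` lies in `core D n` and `|w| ≤ ε` on the rest of `D`. The cutoff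
  -- `w'` inherits this bound and has the same values and Laplacian as `w` on the core.
  refine eq_of_abs_sub_le_all fun ε hε => ?_
  obtain ⟨n₁, hn₁⟩ := exists_abs_le_off_core hDo hDb hne hwc hw0 hε
  refine le_of_tendsto (hlim.const_sub (w x)).abs ?_
  filter_upwards [eventually_ge_atTop n₀, eventually_ge_atTop n₁] with n hn0 hn1
  have hxn : x ∈ core D n := core_mono D hn0 (hn₀ rfl)
  obtain ⟨w', hw', hcs, hle, hout, hnear⟩ := exists_cutoff hDo hDb hw n
  have hε' : ∀ y ∉ core D n, |w' y| ≤ ε := by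
    intro y hy
    by_cases hyD : y ∈ D
    · exact (hle y hyD).trans (hn₁ y hyD fun h => hy (core_mono D hn1 h))
    · rw [hout y hyD, abs_zero]; exact hε.le
  have key := abs_sub_integral_stay_le hX (isClosed_core D n) hxn hw' hcs hμ hε.le hε'
  rw [← integral_exp_mul_eq_killedLaw hμ hm hc (hSn n) (isClosed_core D n).measurableSet
    (hG.mono (core_subset D n)) (fun y hy => hGC y (core_subset D n hy)),
    ← (hnear x hxn).eq_of_nhds]
  convert! key using 3
  refine integral_congr_ae (Eventually.of_forall fun q => ?_)
  simp only
  congr 1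
  refine integral_congr_ae (Eventually.of_forall fun ω => ?_)
  by_cases hω : ω ∈ stay X (core D n) q.toNNReal
  · have hXq := hω _ le_rfl
    simp only [indicator_of_mem hω, G]
    rw [(hnear _ hXq).eq_of_nhds,
      (InnerProductSpace.laplacian_congr_nhds (hnear _ hXq)).eq_of_nhds]
  · simp only [indicator_of_notMem hω]

lemma le_of_ae_le_of_continuousOn (hDo : IsOpen D) {F : Rd d → ℝ} (hF : ContinuousOn F D) {c : ℝ}
    (h : ∀ᵐ y ∂volume.restrict D, F y ≤ c) : ∀ y ∈ D, F y ≤ c := by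
  have hopen : IsOpen (D ∩ F ⁻¹' Ioi c) := hF.isOpen_inter_preimage hDo isOpen_Ioi
  rw [ae_restrict_iff' hDo.measurableSet] at h
  have hnull : volume (D ∩ F ⁻¹' Ioi c) = 0 := by
    refine measure_mono_null ?_ h
    rintro y ⟨hy, hyc⟩ hcon
    exact not_le.2 hyc (hcon hy)
  intro y hy
  by_contra hcon
  have := hopen.eq_empty_of_measure_zero hnull
  exact (this ▸ (⟨hy, not_le.1 hcon⟩ : y ∈ D ∩ F ⁻¹' Ioi c) : y ∈ (∅ : Set (Rd d)))

/-- The Laplacian of a classical solution is bounded. -/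
lemma IsClassicalSolution.exists_laplacian_bound {β : ℝ} (hβ : β ∈ Ioo (0 : ℝ) 1) (hDo : IsOpen D)
    {f : Rd d → ℝ} {u : ℝ → Rd d → ℝ} (hu : IsClassicalSolution D β f u) :
    ∃ L, ∀ t > 0, ∀ y ∈ D, |Laplacian.laplacian (u t) y| ≤ L := by
  obtain ⟨C, hC0, hC⟩ := exists_abs_caputo_le hβ
  obtain ⟨g, hg, hgb⟩ := hu.deriv_bound
  -- The function `g` is only essentially bounded, so the bound first holds for almost every `y`.
  -- Continuity of `Δu(t, ·)` extends it to all of `D`.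
  refine ⟨C * (eLpNorm g ⊤ (volume.restrict D)).toReal, fun t ht => ?_⟩
  have hcont : ContinuousOn (Laplacian.laplacian (u t)) D :=
    hu.continuousOn_laplacian.comp (f := fun y => (t, y)) (by fun_prop) fun y hy => ⟨ht, hy⟩
  refine le_of_ae_le_of_continuousOn hDo hcont.abs ?_
  have hae : ∀ᵐ y ∂volume.restrict D, ‖g y‖ ≤ (eLpNorm g ⊤ (volume.restrict D)).toReal := by
    have h1 := ae_le_eLpNormEssSup (f := g) (μ := volume.restrict D)
    filter_upwards [h1] with y hy
    rw [← eLpNorm_exponent_top] at hy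
    have := ENNReal.toReal_mono hg.2.ne hy
    simpa using this
  filter_upwards [hae, ae_restrict_mem hDo.measurableSet] with y hy hyD
  rw [← hu.equation t ht y hyD]
  refine (hC _ (g y) (fun s hs => hgb s hs y hyD) t ht).trans ?_
  exact mul_le_mul_of_nonneg_left ((le_abs_self _).trans hy) hC0

/-- The Laplace transform in time of a classical solution. -/
theorem IsClassicalSolution.integral_expTime_eq {β : ℝ} (hβ : β ∈ Ioo (0 : ℝ) 1)
    (hX : IsContinuousBrownianMotion P x X) (hDo : IsOpen D)
    (hDb : Bornology.IsBounded D) (hne : Dᶜ.Nonempty) (hx : x ∈ D)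
    {f : Rd d → ℝ} {u : ℝ → Rd d → ℝ} (hu : IsClassicalSolution D β f u) {s : ℝ} (hs : 0 < s) :
    ∫ t, u t x ∂expTime s = ∫ y, f y ∂killedLaw P X D (s ^ β) := by
  obtain ⟨L, hL⟩ := hu.exists_laplacian_bound hβ hDo
  obtain ⟨M, hM⟩ := hu.bounded
  have hμ : 0 < s ^ β := Real.rpow_pos_of_pos hs β
  set μ := s ^ β with hμdef
  have hm := hX.measurable
  have hc := hX.continuous_path
  have hS := measurableSet_staySet_of_isOpen hm hc hDo hne
  have hP := isProbabilityMeasure_expTime hs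
  have hfin := isFiniteMeasure_killedLaw (P := P) (X := X) (K := D) hμ
  set κ := killedLaw P X D μ with hκ
  have hκD : ∀ᵐ y ∂κ, y ∈ D := ae_killedLaw_mem hm hc hS hDo.measurableSet
  have hκr : κ.restrict D = κ := Measure.restrict_eq_self_of_ae_mem hκD
  have her : (expTime s).restrict (Ioi 0) = expTime s :=
    Measure.restrict_eq_self_of_ae_mem (ae_expTime_pos s)
  have hprod : ((expTime s).prod κ).restrict (Ioi 0 ×ˢ D) = (expTime s).prod κ := by
    rw [← Measure.prod_restrict, hκr, her]
  let G : ℝ → Rd d → ℝ := fun t y => μ * u t y - Laplacian.laplacian (u t) y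
  have hucont : ContinuousOn (fun p : ℝ × Rd d => u p.1 p.2) (Ioi 0 ×ˢ D) :=
    hu.continuousOn_closure.mono (prod_mono Ioi_subset_Ici_self subset_closure)
  have hGcont : ContinuousOn (fun p : ℝ × Rd d => G p.1 p.2) (Ioi 0 ×ˢ D) :=
    (continuousOn_const.mul hucont).sub hu.continuousOn_laplacian
  have hGb : ∀ t > 0, ∀ y ∈ D, |G t y| ≤ μ * M + L := fun t ht y hy => by
    refine (abs_sub _ _).trans (add_le_add ?_ (hL t ht y hy))
    rw [abs_mul, abs_of_pos hμ]
    exact mul_le_mul_of_nonneg_left (hM t ht.le y (subset_closure hy)) hμ.le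
  have hGint : Integrable (fun p : ℝ × Rd d => G p.1 p.2) ((expTime s).prod κ) := by
    rw [← hprod]
    have hmeas : MeasurableSet (Ioi (0 : ℝ) ×ˢ D) := measurableSet_Ioi.prod hDo.measurableSet
    refine Integrable.of_bound (hGcont.aestronglyMeasurable hmeas) (μ * M + L) ?_
    filter_upwards [ae_restrict_mem hmeas] with p hp using hGb p.1 hp.1 p.2 hp.2
  have hrep : ∀ t > 0, u t x = μ⁻¹ * ∫ y, G t y ∂κ := fun t ht =>
    eq_integral_killedLaw hX hDo hDb hne hx (hu.contDiffOn_space t ht)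
      (hu.continuousOn_closure.comp (f := fun y => (t, y)) (by fun_prop)
        fun y hy => ⟨ht.le, hy⟩)
      (hu.boundary t ht)
      (hu.continuousOn_laplacian.comp (f := fun y => (t, y)) (by fun_prop) fun y hy => ⟨ht, hy⟩)
      (fun y hy => hM t ht.le y (subset_closure hy)) (hL t ht) hμ
  have e1 : ∫ t, u t x ∂expTime s = μ⁻¹ * ∫ t, ∫ y, G t y ∂κ ∂expTime s := by
    rw [← integral_const_mul]
    refine integral_congr_ae ?_
    filter_upwards [ae_expTime_pos s] with t ht using hrep t ht
  rw [e1, integral_integral_swap hGint]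
  -- By the equation, the mean of `G` in time is `μ E u - E ∂_t^β u = μ E u - μ (E u - f) = μ f`.
  have e2 : ∫ y, ∫ t, G t y ∂expTime s ∂κ = ∫ y, μ * f y ∂κ := by
    refine integral_congr_ae ?_
    filter_upwards [hκD] with y hy
    obtain ⟨g, -, hgb⟩ := hu.deriv_bound
    have hcap := integral_caputo_expTime hβ (U := fun t => u t y)
      (fun t ht => hu.differentiableAt_time t ht y hy)
      ((hu.continuousOn_closure.comp (f := fun t => (t, y)) (by fun_prop)
        fun t ht => ⟨ht, subset_closure hy⟩) 0 self_mem_Ici)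
      (fun t ht => hM t ht y (subset_closure hy)) (fun t ht => hgb t ht y hy) hs
    have hlap : ∫ t, Laplacian.laplacian (u t) y ∂expTime s
        = ∫ t, caputo β (fun t => u t y) t ∂expTime s := by
      refine integral_congr_ae ?_
      filter_upwards [ae_expTime_pos s] with t ht using (hu.equation t ht y hy).symm
    have i1 : Integrable (fun t => u t y) (expTime s) :=
      integrable_of_bound_expTime hs
        ((hucont.comp (f := fun t => (t, y)) (by fun_prop)
          fun t ht => ⟨ht, hy⟩).aestronglyMeasurable measurableSet_Ioi)
        fun t ht => hM t ht.le y (subset_closure hy)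
    have i2 : Integrable (fun t => Laplacian.laplacian (u t) y) (expTime s) :=
      integrable_of_bound_expTime hs
        ((hu.continuousOn_laplacian.comp (f := fun t => (t, y)) (by fun_prop)
          fun t ht => ⟨ht, hy⟩).aestronglyMeasurable measurableSet_Ioi)
        fun t ht => hL t ht y hy
    simp only [G]
    rw [integral_sub (i1.const_mul μ) i2, integral_const_mul, hlap, hcap, hu.initial y hy]
    ring
  rw [e2, integral_const_mul]
  field_simp

end Representation

/-! ### Exit times of continuous paths -/

section ExitTime

variable {d : ℕ} {Ω : Type*} {D : Set (Rd d)}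

/-- The complement of `D` is closed and the path is continuous, so a finite exit time is attained.
Strict inequality therefore means staying in `D` on the closed interval `[0, t]`. -/
lemma lt_exitTime_iff (hD : IsOpen D) {Y : ℝ≥0 → Ω → Rd d} {ω : Ω}
    (hY : Continuous fun s => Y s ω) (t : ℝ≥0) :
    (t : WithTop ℝ≥0) < exitTime D Y ω ↔ ω ∈ stay Y D t := by
  constructor
  · intro h r hr
    have hr' : (r : WithTop ℝ≥0) < hittingAfter Y Dᶜ 0 ω :=
      lt_of_le_of_lt (WithTop.coe_le_coe.2 hr) h
    exact not_not.1 (notMem_of_lt_hittingAfter hr' zero_le)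
  · intro h
    rw [exitTime, hittingAfter_def]
    simp only
    split_ifs with hex
    · rw [WithTop.coe_lt_coe]
      by_contra hle
      have hcl : IsClosed {i : ℝ≥0 | 0 ≤ i ∧ Y i ω ∈ Dᶜ} :=
        isClosed_Ici.inter (hD.isClosed_compl.preimage hY)
      have := hcl.csInf_mem hex (OrderBot.bddBelow _)
      exact this.2 (h _ (not_lt.1 hle))
    · exact WithTop.coe_lt_top t

/-- By the intermediate value theorem and monotonicity, `e` maps `[0, t]` onto `[0, e_t]`, so both
paths visit the same points. -/
lemma mem_stay_timeChange_iff {Y : ℝ≥0 → Ω → Rd d} {e : ℝ≥0 → Ω → ℝ≥0} {ω : Ω}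
    (he : Continuous fun s => e s ω) (hm : Monotone fun s => e s ω) (h0 : e 0 ω = 0) (t : ℝ≥0) :
    ω ∈ stay (timeChange Y e) D t ↔ ω ∈ stay Y D (e t ω) := by
  constructor
  · intro h r hr
    obtain ⟨s, hs, rfl⟩ := intermediate_value_Icc (zero_le (a := t)) he.continuousOn
      (show r ∈ Icc (e 0 ω) (e t ω) from ⟨by simp [h0], hr⟩)
    exact h s hs.2
  · intro h s hs
    exact h _ (hm hs)

theorem lt_exitTime_timeChange_iff (hD : IsOpen D) {Y : ℝ≥0 → Ω → Rd d} {e : ℝ≥0 → Ω → ℝ≥0}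
    {ω : Ω} (hY : Continuous fun s => Y s ω) (he : Continuous fun s => e s ω)
    (hm : Monotone fun s => e s ω) (h0 : e 0 ω = 0) (t : ℝ≥0) :
    (t : WithTop ℝ≥0) < exitTime D (timeChange Y e) ω ↔
      (e t ω : WithTop ℝ≥0) < exitTime D Y ω := by
  rw [lt_exitTime_iff hD hY, lt_exitTime_iff (Y := timeChange Y e) hD (hY.comp he),
    mem_stay_timeChange_iff he hm h0]

end ExitTime

/-! ### The inverse of a strictly increasing subordinator -/

/-- A stable subordinator all of whose paths are strictly increasing and unbounded. -/
structure IsStrictSubordinator {Ω : Type*} [MeasurableSpace Ω] (P : Measure Ω) (β : ℝ)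
    (S : ℝ≥0 → Ω → ℝ) : Prop where
  measurable : ∀ t, Measurable (S t)
  start_eq : ∀ ω, S 0 ω = 0
  strictMono : ∀ ω, StrictMono fun t => S t ω
  unbounded : ∀ ω M, ∃ r, M < S r ω
  laplace : ∀ (t : ℝ≥0) (θ : ℝ), 0 < θ →
    ∫ ω, Real.exp (-θ * S t ω) ∂P = Real.exp (-t * θ ^ β)

section Inverse

variable {Ω : Type*} {S : ℝ≥0 → Ω → ℝ} {ω : Ω}

lemma inverseProcess_le {t r : ℝ≥0} (hr : 0 < r) (h : (t : ℝ) < S r ω) :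
    inverseProcess S t ω ≤ r :=
  csInf_le (OrderBot.bddBelow _) ⟨hr, h⟩

lemma nonempty_inverse_set (h0 : S 0 ω = 0) (hu : ∀ M, ∃ r, M < S r ω) (t : ℝ≥0) :
    {r : ℝ≥0 | 0 < r ∧ (t : ℝ) < S r ω}.Nonempty := by
  obtain ⟨r, hr⟩ := hu t
  refine ⟨r, pos_iff_ne_zero.2 ?_, hr⟩
  rintro rfl
  rw [h0] at hr
  exact absurd hr (not_lt.2 t.2)

/-- With `le_of_lt_inverseProcess` this sandwiches `{S_r ≤ t}` between `{r < E_t}` and `{r ≤ E_t}`;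
the two differ only when `r = E_t`. -/
lemma le_inverseProcess (h0 : S 0 ω = 0) (hs : StrictMono fun t => S t ω)
    (hu : ∀ M, ∃ r, M < S r ω) {t r : ℝ≥0} (h : S r ω ≤ t) : r ≤ inverseProcess S t ω := by
  refine le_csInf (nonempty_inverse_set h0 hu t) fun r' hr' => ?_
  exact (hs.lt_iff_lt.1 (h.trans_lt hr'.2)).le

lemma inverseProcess_lt_iff (h0 : S 0 ω = 0) (hu : ∀ M, ∃ r, M < S r ω) {t c : ℝ≥0} :
    inverseProcess S t ω < c ↔ ∃ r, 0 < r ∧ r < c ∧ (t : ℝ) < S r ω := by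
  rw [inverseProcess, csInf_lt_iff (OrderBot.bddBelow _) (nonempty_inverse_set h0 hu t)]
  exact ⟨fun ⟨r, hr, hc⟩ => ⟨r, hr.1, hc, hr.2⟩, fun ⟨r, hr, hc, h⟩ => ⟨r, ⟨hr, h⟩, hc⟩⟩

lemma le_of_lt_inverseProcess (h0 : S 0 ω = 0) {t r : ℝ≥0} (h : r < inverseProcess S t ω) :
    S r ω ≤ t := by
  by_contra hcon
  rcases eq_or_ne r 0 with rfl | hr
  · rw [h0] at hcon
    exact hcon t.2
  · exact absurd (inverseProcess_le (pos_iff_ne_zero.2 hr) (not_le.1 hcon)) (not_le.2 h)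

lemma monotone_inverseProcess (h0 : S 0 ω = 0) (hu : ∀ M, ∃ r, M < S r ω) :
    Monotone fun t => inverseProcess S t ω := by
  intro t t' h
  refine le_csInf (nonempty_inverse_set h0 hu t') fun r hr => ?_
  exact inverseProcess_le hr.1 (lt_of_le_of_lt (by exact_mod_cast h) hr.2)

lemma inverseProcess_zero (h0 : S 0 ω = 0) (hs : StrictMono fun t => S t ω) :
    inverseProcess S 0 ω = 0 := by
  refine le_antisymm (le_of_forall_gt_imp_ge_of_dense fun r hr => ?_) zero_le
  refine inverseProcess_le hr ?_
  have := hs hr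
  simp only [h0] at this
  exact_mod_cast this

/-- A flat stretch of `S` would be a jump of `E`. For `c < r' < r < E_t`, strict monotonicity gives
`S r' < S r ≤ t`, so `S r' < s` and `c < r' ≤ E_s` for `s` near `t`. The upper bound follows from
the infimum alone. -/
lemma continuous_inverseProcess (h0 : S 0 ω = 0) (hs : StrictMono fun t => S t ω)
    (hu : ∀ M, ∃ r, M < S r ω) : Continuous fun t => inverseProcess S t ω := by
  refine continuous_iff_continuousAt.2 fun t => ?_
  refine tendsto_order.2 ⟨fun c hc => ?_, fun c hc => ?_⟩
  · obtain ⟨r', h1, h2⟩ := exists_between hc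
    obtain ⟨r, h3, h4⟩ := exists_between h2
    have h5 : S r' ω < t := (hs h3).trans_le (le_of_lt_inverseProcess h0 h4)
    have h6 : ∀ᶠ s : ℝ≥0 in 𝓝 t, S r' ω < s :=
      (NNReal.continuous_coe.tendsto t).eventually (lt_mem_nhds h5)
    filter_upwards [h6] with s hs6
    exact h1.trans_le (le_inverseProcess h0 hs hu hs6.le)
  · obtain ⟨r, hr, hrc, hrt⟩ := (inverseProcess_lt_iff h0 hu).1 hc
    have h6 : ∀ᶠ s : ℝ≥0 in 𝓝 t, (s : ℝ) < S r ω :=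
      (NNReal.continuous_coe.tendsto t).eventually (gt_mem_nhds hrt)
    filter_upwards [h6] with s hs6
    exact (inverseProcess_le hr hs6).trans_lt hrc

/-- As `S` increases, a witness for `E_t < c` can be moved up to a dense sequence of times. Only
measurability of the individual `S t` is assumed, so the lemma also applies to the σ-algebra
generated by `S`, which yields independence of `X`. -/
lemma measurable_inverseProcess_apply [MeasurableSpace Ω] (hm : ∀ t, Measurable (S t))
    (h0 : ∀ ω, S 0 ω = 0) (hs : ∀ ω, StrictMono fun t => S t ω)
    (hu : ∀ ω M, ∃ r, M < S r ω) (t : ℝ≥0) : Measurable (inverseProcess S t) := by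
  refine measurable_of_Iio fun c => ?_
  have : inverseProcess S t ⁻¹' Iio c = ⋃ n : ℕ, {ω | 0 < TopologicalSpace.denseSeq ℝ≥0 n ∧
      TopologicalSpace.denseSeq ℝ≥0 n < c ∧ (t : ℝ) < S (TopologicalSpace.denseSeq ℝ≥0 n) ω} := by
    ext ω
    rw [mem_preimage, mem_Iio, inverseProcess_lt_iff (h0 ω) (hu ω), mem_iUnion]
    constructor
    · rintro ⟨r, hr, hrc, hrt⟩
      obtain ⟨q, ⟨n, rfl⟩, hq⟩ :=
        (TopologicalSpace.denseRange_denseSeq ℝ≥0).exists_between hrc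
      exact ⟨n, hr.trans hq.1, hq.2, hrt.trans (hs ω hq.1)⟩
    · rintro ⟨n, hn⟩
      exact ⟨_, hn⟩
  rw [this]
  refine MeasurableSet.iUnion fun n => ?_
  refine (MeasurableSet.const _).inter ((MeasurableSet.const _).inter ?_)
  exact measurableSet_lt measurable_const (hm _)

variable [MeasurableSpace Ω] {P : Measure Ω} {β : ℝ}

lemma measurable_uncurry_inverseProcess (hS : IsStrictSubordinator P β S) :
    Measurable fun p : ℝ≥0 × Ω => inverseProcess S p.1 p.2 :=
  measurable_uncurry_of_continuous_of_measurable
    (fun ω => continuous_inverseProcess (hS.start_eq ω) (hS.strictMono ω) (hS.unbounded ω))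
    (measurable_inverseProcess_apply hS.measurable hS.start_eq hS.strictMono hS.unbounded)

/-- For a fixed path the exponential time exceeds `S_a` with probability `exp (-s S_a)`. Averaging
over paths gives the Laplace transform of `S_a`. -/
lemma measure_subordinator_le_expTime [IsProbabilityMeasure P]
    (hS : IsStrictSubordinator P β S) {s : ℝ} (hs : 0 < s)
    (a : ℝ≥0) :
    ((expTime s).prod P) {p : ℝ × Ω | S a p.2 ≤ (p.1.toNNReal : ℝ)} =
      ENNReal.ofReal (Real.exp (-(s ^ β * a))) := by
  have := isProbabilityMeasure_expTime hs
  have hmeas : MeasurableSet {p : ℝ × Ω | S a p.2 ≤ (p.1.toNNReal : ℝ)} :=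
    measurableSet_le ((hS.measurable a).comp measurable_snd) (by fun_prop)
  have hnn : ∀ ω, 0 ≤ S a ω := fun ω => by
    rw [← hS.start_eq ω]
    exact (hS.strictMono ω).monotone zero_le
  have hslice : ∀ ω, expTime s ((fun t => (t, ω)) ⁻¹' {p : ℝ × Ω | S a p.2 ≤ (p.1.toNNReal : ℝ)})
      = ENNReal.ofReal (Real.exp (-s * S a ω)) := by
    intro ω
    rw [neg_mul, ← expTime_Ioi hs (hnn ω)]
    apply measure_congr
    filter_upwards [ae_expTime_pos s, ae_expTime_ne s (S a ω)] with t ht hne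
    refine propext ⟨fun h => ?_, fun h => ?_⟩
    · have h : S a ω ≤ (t.toNNReal : ℝ) := h
      rw [Real.coe_toNNReal _ ht.le] at h
      exact lt_of_le_of_ne h hne.symm
    · have h : S a ω < t := h
      change S a ω ≤ (t.toNNReal : ℝ)
      rw [Real.coe_toNNReal _ ht.le]
      exact h.le
  rw [Measure.prod_apply_symm hmeas]
  simp_rw [hslice]
  rw [← ofReal_integral_eq_lintegral_ofReal, hS.laplace a s hs]
  · congr 2; ring
  · by_contra hcon
    have h1 := hS.laplace a s hs
    rw [integral_undef hcon] at h1
    exact (Real.exp_pos _).ne h1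
  · exact Eventually.of_forall fun ω => (Real.exp_pos _).le

/-- The inverse process at an independent exponential time of rate `s` is exponential of
rate `s ^ β`. -/
lemma map_inverseProcess_expTime [IsProbabilityMeasure P]
    (hS : IsStrictSubordinator P β S) {s : ℝ} (hs : 0 < s) :
    ((expTime s).prod P).map (fun p => inverseProcess S p.1.toNNReal p.2) =
      (expTime (s ^ β)).map Real.toNNReal := by
  have := isProbabilityMeasure_expTime hs
  have hμ : 0 < s ^ β := Real.rpow_pos_of_pos hs β
  have := isProbabilityMeasure_expTime hμ
  have hEm : Measurable fun p : ℝ × Ω => inverseProcess S p.1.toNNReal p.2 :=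
    (measurable_uncurry_inverseProcess hS).comp
      ((measurable_real_toNNReal.comp measurable_fst).prodMk measurable_snd)
  have := Measure.isProbabilityMeasure_map (μ := (expTime s).prod P) hEm.aemeasurable
  refine Measure.ext_of_Ici _ _ fun a => ?_
  rw [Measure.map_apply hEm measurableSet_Ici, Measure.map_apply measurable_real_toNNReal
    measurableSet_Ici]
  have hright : expTime (s ^ β) (Real.toNNReal ⁻¹' Ici a) =
      ENNReal.ofReal (Real.exp (-(s ^ β * a))) := by
    rw [← expTime_Ioi hμ (NNReal.coe_nonneg a)]
    apply measure_congr
    filter_upwards [ae_expTime_pos (s ^ β), ae_expTime_ne (s ^ β) a] with t ht hne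
    refine propext ⟨fun h => ?_, fun h => ?_⟩
    · have h : a ≤ t.toNNReal := h
      exact lt_of_le_of_ne ((Real.le_toNNReal_iff_coe_le ht.le).1 h) hne.symm
    · have h : (a : ℝ) < t := h
      exact (Real.le_toNNReal_iff_coe_le ht.le).2 h.le
  rw [hright]
  refine le_antisymm ?_ ?_
  · rcases eq_or_ne a 0 with rfl | ha
    · simp
    · have hlim : Tendsto (fun a' : ℝ≥0 => ENNReal.ofReal (Real.exp (-(s ^ β * a')))) (𝓝[<] a)
          (𝓝 (ENNReal.ofReal (Real.exp (-(s ^ β * a))))) := by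
        refine ((ENNReal.continuous_ofReal.comp ?_).tendsto a).mono_left nhdsWithin_le_nhds
        fun_prop
      have hne : (𝓝[<] a).NeBot := nhdsLT_neBot_of_exists_lt ⟨0, pos_iff_ne_zero.2 ha⟩
      refine ge_of_tendsto hlim ?_
      filter_upwards [self_mem_nhdsWithin] with a' ha'
      rw [← measure_subordinator_le_expTime hS hs a']
      refine measure_mono fun p hp => ?_
      exact le_of_lt_inverseProcess (hS.start_eq _) (lt_of_lt_of_le ha' hp)
  · rw [← measure_subordinator_le_expTime hS hs a]
    refine measure_mono fun p hp => ?_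
    exact le_inverseProcess (hS.start_eq _) (hS.strictMono _) (hS.unbounded _) hp

end Inverse

/-! ### The killed process at the inverse time -/

section RandomTime

variable {d : ℕ} {Ω : Type*} {D : Set (Rd d)} {X : ℝ≥0 → Ω → Rd d}

/-- The value `f (X_q)` if the path has not left `D` up to time `q`, and `0` otherwise. -/
def killedValue (X : ℝ≥0 → Ω → Rd d) (D : Set (Rd d)) (f : Rd d → ℝ) (q : ℝ≥0) (ω : Ω) : ℝ :=
  (stay X D q).indicator (fun ω => f (X q ω)) ω

lemma abs_killedValue_le {f : Rd d → ℝ} {M : ℝ} (hM0 : 0 ≤ M) (hM : ∀ y ∈ D, |f y| ≤ M)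
    (q : ℝ≥0) (ω : Ω) : |killedValue X D f q ω| ≤ M := by
  by_cases h : ω ∈ stay X D q
  · rw [killedValue, indicator_of_mem h]
    exact hM _ (h q le_rfl)
  · rw [killedValue, indicator_of_notMem h, abs_zero]
    exact hM0

/-- On the staying event `X_q` lies in `D`, so `f` may be replaced by its extension by zero, which
is measurable everywhere. -/
lemma measurable_killedValue [MeasurableSpace Ω] (hm : ∀ t, Measurable (X t))
    (hc : ∀ ω, Continuous fun t => X t ω) (hDo : IsOpen D) (hne : Dᶜ.Nonempty) {f : Rd d → ℝ}
    (hf : ContinuousOn f D) : Measurable fun p : ℝ≥0 × Ω => killedValue X D f p.1 p.2 := by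
  have hf' : Measurable (D.indicator f) := by
    classical
    rw [← piecewise_eq_indicator]
    exact hf.measurable_piecewise continuousOn_const hDo.measurableSet
  have hS := measurableSet_staySet_of_isOpen hm hc hDo hne
  have heq : (fun p : ℝ≥0 × Ω => killedValue X D f p.1 p.2) =
      (staySet X D).indicator fun p => D.indicator f (X p.1 p.2) := by
    ext p
    by_cases h : p ∈ staySet X D
    · have h' : p.2 ∈ stay X D p.1 := h
      rw [indicator_of_mem h, killedValue, indicator_of_mem h', indicator_of_mem (h' _ le_rfl)]
    · have h' : p.2 ∉ stay X D p.1 := h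
      rw [indicator_of_notMem h, killedValue, indicator_of_notMem h']
  rw [heq]
  exact (hf'.comp (measurable_uncurry_process hm hc)).indicator hS

/-- `killedValue` is right-continuous along the time change by a continuous monotone path. -/
lemma tendsto_killedValue_right (hDo : IsOpen D) {f : Rd d → ℝ} (hf : ContinuousOn f D) {ω : Ω}
    (hc : Continuous fun t => X t ω) {e : ℝ≥0 → ℝ≥0} (he : Continuous e) (hmono : Monotone e)
    (t : ℝ≥0) :
    Tendsto (fun s => killedValue X D f (e s) ω) (𝓝[>] t) (𝓝 (killedValue X D f (e t) ω)) := by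
  by_cases h : ω ∈ stay X D (e t)
  · have hDt : X (e t) ω ∈ D := h _ le_rfl
    -- A path still in the open set `D` at time `e t` remains there until some `b > e t`, so the
    -- indicator is locally constant to the right of `t`. A path that has already left stays killed.
    obtain ⟨b, hb, hbD⟩ := exists_Ico_subset_of_mem_nhds (a := e t)
      (hc.continuousAt.preimage_mem_nhds (hDo.mem_nhds hDt)) ⟨e t + 1, by simp⟩
    have hev : ∀ᶠ s in 𝓝[>] t, e s < b :=
      (he.continuousAt.eventually (gt_mem_nhds hb)).filter_mono nhdsWithin_le_nhds
    rw [killedValue, indicator_of_mem h]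
    have hlim : Tendsto (fun s => f (X (e s) ω)) (𝓝[>] t) (𝓝 (f (X (e t) ω))) :=
      (((hf.continuousAt (hDo.mem_nhds hDt)).tendsto.comp
        ((hc.tendsto _).comp (he.tendsto t)))).mono_left nhdsWithin_le_nhds
    refine hlim.congr' ?_
    filter_upwards [hev] with s hs
    have hstay : ω ∈ stay X D (e s) := fun r hr => by
      rcases le_or_gt r (e t) with hle | hlt
      · exact h r hle
      · exact hbD ⟨hlt.le, hr.trans_lt hs⟩
    rw [killedValue, indicator_of_mem hstay]
  · rw [killedValue, indicator_of_notMem h]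
    refine Tendsto.congr' (f₁ := fun _ => 0) ?_ tendsto_const_nhds
    filter_upwards [self_mem_nhdsWithin] with s hs
    have hstay : ω ∉ stay X D (e s) := fun hcon =>
      h fun r hr => hcon r (hr.trans (hmono (le_of_lt hs)))
    rw [killedValue, indicator_of_notMem hstay]

lemma measurable_eval_comap {Ω₁ E : Type*} [MeasurableSpace E] (Z : ℝ≥0 → Ω₁ → E) (t : ℝ≥0) :
    Measurable[MeasurableSpace.comap (fun ω t => Z t ω) inferInstance] (Z t) := by
  rw [measurable_iff_comap_le, show Z t = (fun g : ℝ≥0 → E => g t) ∘ fun ω t => Z t ω from rfl,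
    ← MeasurableSpace.comap_comp]
  exact MeasurableSpace.comap_mono (measurable_pi_apply t).comap_le

/-- Conditioning on an independent random variable. -/
lemma integral_comp_prodMk_of_indepFun {Ω₁ Ω' : Type*} [MeasurableSpace Ω₁] [MeasurableSpace Ω']
    {P : Measure Ω₁} [IsProbabilityMeasure P] {T : Ω₁ → ℝ≥0} {g : Ω₁ → Ω'} (hT : Measurable T)
    (hg : Measurable g)
    (hind : Indep (MeasurableSpace.comap T inferInstance) (MeasurableSpace.comap g inferInstance) P)
    {F : ℝ≥0 × Ω' → ℝ} (hF : Measurable F) {M : ℝ}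
    (hM : ∀ p, |F p| ≤ M) :
    ∫ ω, F (T ω, g ω) ∂P = ∫ ω, ∫ ω', F (T ω, g ω') ∂P ∂P := by
  have := Measure.isProbabilityMeasure_map (μ := P) hT.aemeasurable
  have := Measure.isProbabilityMeasure_map (μ := P) hg.aemeasurable
  have hint : Integrable F ((P.map T).prod (P.map g)) :=
    Integrable.of_bound hF.aestronglyMeasurable M (Eventually.of_forall hM)
  have e1 : ∫ ω, F (T ω, g ω) ∂P = ∫ p, F p ∂((P.map T).prod (P.map g)) := by
    rw [← (indepFun_iff_map_prod_eq_prod_map_map hT.aemeasurable hg.aemeasurable).1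
        ((IndepFun_iff_Indep _ _ _).2 hind),
      integral_map (by fun_prop) hF.aestronglyMeasurable]
  rw [e1, integral_prod _ hint, integral_map hT.aemeasurable
    hF.stronglyMeasurable.integral_prod_right'.aestronglyMeasurable]
  refine integral_congr_ae (Eventually.of_forall fun ω => ?_)
  exact integral_map hg.aemeasurable (hF.comp measurable_prodMk_left).aestronglyMeasurable

/-- Conditioning on a random time independent of the path. -/
lemma integral_killedValue_of_indepFun {mΩ : MeasurableSpace Ω} {P : Measure Ω}
    [IsProbabilityMeasure P] (hm : ∀ t, Measurable (X t))
    (hc : ∀ ω, Continuous fun t => X t ω) (hDo : IsOpen D) (hne : Dᶜ.Nonempty) {f : Rd d → ℝ}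
    (hf : ContinuousOn f D) {M : ℝ} (hM0 : 0 ≤ M) (hM : ∀ y ∈ D, |f y| ≤ M) {T : Ω → ℝ≥0}
    (hT : Measurable T) (hind : IndepFun T (fun ω t => X t ω) P) :
    ∫ ω, killedValue X D f (T ω) ω ∂P = ∫ ω, ∫ ω', killedValue X D f (T ω) ω' ∂P ∂P := by
  have hpath : Measurable fun ω t => X t ω := measurable_pi_lambda _ hm
  -- The path itself serves as the independent variable: `id` into `Ω` with the σ-algebra generated
  -- by `X`. Continuity of all paths then remains available when joint measurability is checked.
  refine @integral_comp_prodMk_of_indepFun Ω Ω mΩ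
    (MeasurableSpace.comap (fun ω t => X t ω) inferInstance) P _ T id hT
    (measurable_id'' hpath.comap_le) ?_ (fun p => killedValue X D f p.1 p.2) ?_ M
    (fun p => abs_killedValue_le hM0 hM p.1 p.2)
  · rw [MeasurableSpace.comap_id]
    exact (IndepFun_iff_Indep _ _ _).1 hind
  · refine @measurable_killedValue d Ω D X
      (MeasurableSpace.comap (fun ω t => X t ω) inferInstance) (measurable_eval_comap X) hc hDo hne f hf

end RandomTime

/-! ### Matching the two Laplace transforms. -/

section Main

variable {d : ℕ} {Ω : Type*} [MeasurableSpace Ω] {P : Measure Ω}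
  {x : Rd d} {X : ℝ≥0 → Ω → Rd d} {S : ℝ≥0 → Ω → ℝ} {D : Set (Rd d)} {β : ℝ}

lemma indepFun_inverseProcess (hS : IsStrictSubordinator P β S)
    (hXS : IndepFun (fun ω t => X t ω) (fun ω t => S t ω) P) (t : ℝ≥0) :
    IndepFun (inverseProcess S t) (fun ω t => X t ω) P := by
  refine IndepFun.symm ?_
  rw [IndepFun_iff_Indep] at hXS ⊢
  refine indep_of_indep_of_le_right hXS ?_
  rw [← measurable_iff_comap_le]
  refine @measurable_inverseProcess_apply Ω S (MeasurableSpace.comap (fun ω t => S t ω) inferInstance)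
    (measurable_eval_comap S) hS.start_eq hS.strictMono hS.unbounded t

/-- The Laplace transform in time of the killed process at the inverse time. -/
lemma integral_killedValue_inverseProcess [IsProbabilityMeasure P]
    (hX : IsContinuousBrownianMotion P x X)
    (hS : IsStrictSubordinator P β S)
    (hXS : IndepFun (fun ω t => X t ω) (fun ω t => S t ω) P) (hDo : IsOpen D)
    (hne : Dᶜ.Nonempty) {f : Rd d → ℝ} (hf : ContinuousOn f D) {M : ℝ} (hM0 : 0 ≤ M)
    (hM : ∀ y ∈ D, |f y| ≤ M) {s : ℝ} (hs : 0 < s) :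
    ∫ t, ∫ ω, killedValue X D f (inverseProcess S t.toNNReal ω) ω ∂P ∂expTime s =
      ∫ y, f y ∂killedLaw P X D (s ^ β) := by
  have hm := hX.measurable
  have hc := hX.continuous_path
  have hμ : 0 < s ^ β := Real.rpow_pos_of_pos hs β
  have := isProbabilityMeasure_expTime hs
  have hmE := measurable_inverseProcess_apply hS.measurable hS.start_eq hS.strictMono hS.unbounded
  have hEm : Measurable fun p : ℝ × Ω => inverseProcess S p.1.toNNReal p.2 :=
    (measurable_uncurry_inverseProcess hS).comp
      ((measurable_real_toNNReal.comp measurable_fst).prodMk measurable_snd)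
  let h : ℝ≥0 → ℝ := fun q => ∫ ω', killedValue X D f q ω' ∂P
  have hh : StronglyMeasurable h :=
    (measurable_killedValue hm hc hDo hne hf).stronglyMeasurable.integral_prod_right'
  have hhM : ∀ q, |h q| ≤ M := fun q => by
    have := norm_integral_le_of_norm_le_const (μ := P) (C := M)
      (f := fun ω' => killedValue X D f q ω')
      (Eventually.of_forall fun ω => abs_killedValue_le hM0 hM q ω)
    simpa [h] using this
  -- Conditioning on `E_t` leaves the mean of `h (E_t)`, so at an exponential time only the law of
  -- `E_T` enters.
  simp_rw [fun t : ℝ => integral_killedValue_of_indepFun hm hc hDo hne hf hM0 hM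
    (hmE t.toNNReal) (indepFun_inverseProcess hS hXS t.toNNReal)]
  rw [integral_killedLaw hμ hm hc (measurableSet_staySet_of_isOpen hm hc hDo hne)
    hDo.measurableSet hf hM, ← map_inverseProcess_expTime hS hs,
    integral_map hEm.aemeasurable (by exact hh.aestronglyMeasurable), integral_prod]
  · rfl
  · exact Integrable.of_bound (hh.comp_measurable hEm).aestronglyMeasurable M
      (Eventually.of_forall fun p => hhM _)

/-- The stochastic representation for everywhere regular paths. -/
theorem IsClassicalSolution.eq_integral_killedValue [IsProbabilityMeasure P]
    (hβ : β ∈ Ioo (0 : ℝ) 1)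
    (hX : IsContinuousBrownianMotion P x X) (hS : IsStrictSubordinator P β S)
    (hXS : IndepFun (fun ω t => X t ω) (fun ω t => S t ω) P) (hDo : IsOpen D)
    (hDb : Bornology.IsBounded D) (hne : Dᶜ.Nonempty) (hx : x ∈ closure D)
    {f : Rd d → ℝ} {u : ℝ → Rd d → ℝ} (hu : IsClassicalSolution D β f u) (t : ℝ≥0) :
    Integrable (fun ω => killedValue X D f (inverseProcess S t ω) ω) P ∧
      u t x = ∫ ω, killedValue X D f (inverseProcess S t ω) ω ∂P := by
  have hm := hX.measurable
  have hc := hX.continuous_path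
  have hcE := fun ω =>
    continuous_inverseProcess (hS.start_eq ω) (hS.strictMono ω) (hS.unbounded ω)
  obtain ⟨M, hM⟩ := hu.bounded
  have hM0 : 0 ≤ M := (abs_nonneg _).trans (hM 0 le_rfl x hx)
  have hfM : ∀ y ∈ D, |f y| ≤ M := fun y hy => by
    rw [← hu.initial y hy]; exact hM 0 le_rfl y (subset_closure hy)
  have hf : ContinuousOn f D :=
    (hu.continuousOn_closure.comp (f := fun y => ((0 : ℝ), y)) (by fun_prop)
      fun y hy => ⟨self_mem_Ici, subset_closure hy⟩).congr fun y hy => (hu.initial y hy).symm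
  have hjoint : Measurable fun p : ℝ × Ω =>
      killedValue X D f (inverseProcess S p.1.toNNReal p.2) p.2 :=
    (measurable_killedValue hm hc hDo hne hf).comp
      (((measurable_uncurry_inverseProcess hS).comp
        ((measurable_real_toNNReal.comp measurable_fst).prodMk measurable_snd)).prodMk
        measurable_snd)
  have hmeas : ∀ t : ℝ, Measurable fun ω =>
      killedValue X D f (inverseProcess S t.toNNReal ω) ω := fun t => by
    have h1 : Measurable fun ω : Ω => (t, ω) := measurable_prodMk_left
    have h2 := hjoint.comp h1
    exact h2
  have hbound : ∀ (t : ℝ) ω, ‖killedValue X D f (inverseProcess S t.toNNReal ω) ω‖ ≤ M :=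
    fun t ω => abs_killedValue_le hM0 hfM _ ω
  have hut : ContinuousOn (fun s => u s x) (Ici 0) :=
    hu.continuousOn_closure.comp (f := fun s => (s, x)) (by fun_prop) fun s hs => ⟨hs, hx⟩
  refine ⟨Integrable.of_bound (by simpa using (hmeas t).aestronglyMeasurable) M
    (Eventually.of_forall fun ω => by simpa using hbound t ω), ?_⟩
  by_cases hxD : x ∈ D
  · let v : ℝ → ℝ := fun t => ∫ ω, killedValue X D f (inverseProcess S t.toNNReal ω) ω ∂P
    have hv : Tendsto v (𝓝[>] (t : ℝ)) (𝓝 (v t)) := by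
      refine tendsto_integral_filter_of_dominated_convergence (fun _ => M)
        (Eventually.of_forall fun s => (hmeas s).aestronglyMeasurable)
        (Eventually.of_forall fun s => Eventually.of_forall (hbound s)) (integrable_const M)
        (Eventually.of_forall fun ω => ?_)
      have h1 := tendsto_killedValue_right hDo hf (hc ω) (hcE ω)
        (monotone_inverseProcess (hS.start_eq ω) (hS.unbounded ω)) t
      rw [Real.toNNReal_coe]
      refine h1.comp (tendsto_nhdsWithin_iff.2 ⟨?_, ?_⟩)
      · have := (continuous_real_toNNReal.tendsto (t : ℝ)).mono_left
          (nhdsWithin_le_nhds (s := Ioi (t : ℝ)))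
        rwa [Real.toNNReal_coe] at this
      · filter_upwards [self_mem_nhdsWithin] with s hs
        exact Real.lt_toNNReal_iff_coe_lt.2 hs
    have := eq_of_laplace_eq (a := fun s => u s x) (b := v) (M := M)
      ((hut.mono Ioi_subset_Ici_self).aestronglyMeasurable measurableSet_Ioi)
      (hjoint.stronglyMeasurable.integral_prod_right'.aestronglyMeasurable)
      (fun s hs => hM s (le_of_lt hs) x hx)
      (fun s _ => by
        have := norm_integral_le_of_norm_le_const (μ := P) (Eventually.of_forall (hbound s))
        simpa [v] using this)
      (fun s hs => by
        rw [hu.integral_expTime_eq hβ hX hDo hDb hne hxD hs]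
        exact (integral_killedValue_inverseProcess hX hS hXS hDo hne hf hM0 hfM hs).symm)
      (NNReal.coe_nonneg t)
      ((hut t (NNReal.coe_nonneg t)).mono (Ioi_subset_Ici (NNReal.coe_nonneg t))) hv
    simpa [v] using this
  · have hxf : x ∈ frontier D := ⟨hx, by rwa [hDo.interior_eq]⟩
    have h0 : ∀ ω, killedValue X D f (inverseProcess S t ω) ω = 0 := fun ω => by
      rw [killedValue, indicator_of_notMem]
      intro hcon
      exact hxD (hX.start_eq ω ▸ hcon 0 zero_le)
    simp only [h0, integral_zero]
    -- The boundary condition is given for positive times only; continuity in time carries it to `t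
    -- = 0`.
    have h1 : Tendsto (fun s => u s x) (𝓝[>] (t : ℝ)) (𝓝 (u t x)) :=
      (hut t (NNReal.coe_nonneg t)).mono (Ioi_subset_Ici (NNReal.coe_nonneg t))
    refine tendsto_nhds_unique h1 (Tendsto.congr' (f₁ := fun _ => 0) ?_ tendsto_const_nhds)
    filter_upwards [self_mem_nhdsWithin] with s hs
    exact (hu.boundary s ((NNReal.coe_nonneg t).trans_lt hs) x hxf).symm

end Main

/-! ### Regular versions of the processes -/

section Versions

variable {d : ℕ} {Ω : Type*} [MeasurableSpace Ω] {P : Measure Ω}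

lemma hasIndepIncrements_congr_ae {E : Type*} [MeasurableSpace E] [Sub E] {X Y : ℝ≥0 → Ω → E}
    (h : ∀ᵐ ω ∂P, ∀ t, X t ω = Y t ω) (hX : HasIndepIncrements X P) :
    HasIndepIncrements Y P := fun n t ht => by
  refine (hX n t ht).congr fun i => ?_
  filter_upwards [h] with ω hω
  simp only [hω]

lemma exists_measurableSet_of_ae {p : Ω → Prop} (h : ∀ᵐ ω ∂P, p ω) :
    ∃ G : Set Ω, MeasurableSet G ∧ (∀ ω ∈ G, p ω) ∧ ∀ᵐ ω ∂P, ω ∈ G := by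
  obtain ⟨B, hB, hBm, hB0⟩ := exists_measurable_superset_of_null (ae_iff.1 h)
  refine ⟨Bᶜ, hBm.compl, fun ω hω => ?_, ?_⟩
  · by_contra hcon
    exact hω (hB hcon)
  · exact compl_mem_ae_iff.2 hB0

lemma IsBrownianMotion.exists_continuous_version {x : Rd d} {X : ℝ≥0 → Ω → Rd d}
    (hX : IsBrownianMotion P x X) :
    ∃ X' : ℝ≥0 → Ω → Rd d, IsContinuousBrownianMotion P x X' ∧
      ∀ᵐ ω ∂P, ∀ t, X t ω = X' t ω := by
  classical
  obtain ⟨G, hGm, hG, hGae⟩ := exists_measurableSet_of_ae (hX.start.and hX.continuous)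
  let X' : ℝ≥0 → Ω → Rd d := fun t => G.piecewise (X t) fun _ => x
  have hae : ∀ᵐ ω ∂P, ∀ t, X t ω = X' t ω := by
    filter_upwards [hGae] with ω hω t
    simp [X', hω]
  have hstart : ∀ ω, X' 0 ω = x := fun ω => by
    by_cases hω : ω ∈ G
    · simp [X', hω, (hG ω hω).1]
    · simp [X', hω]
  have hcont : ∀ ω, Continuous fun t => X' t ω := fun ω => by
    by_cases hω : ω ∈ G
    · simpa [X', hω] using (hG ω hω).2
    · simp [X', hω, continuous_const]
  refine ⟨X', ⟨⟨fun t => (hX.measurable t).piecewise hGm measurable_const,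
    Eventually.of_forall hstart, hasIndepIncrements_congr_ae hae hX.indep, fun s t hst => ?_,
    Eventually.of_forall hcont⟩, hstart, hcont⟩, hae⟩
  refine (hX.law s t hst).congr ?_
  filter_upwards [hae] with ω hω
  simp only [hω]

variable {β : ℝ} {S : ℝ≥0 → Ω → ℝ}

lemma IsStableSubordinator.integrable_exp (hS : IsStableSubordinator P β S) (t : ℝ≥0) {θ : ℝ}
    (hθ : 0 < θ) : Integrable (fun ω => Real.exp (-θ * S t ω)) P := by
  by_contra hcon
  have h1 := hS.laplace t θ hθ
  rw [integral_undef hcon] at h1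
  exact (Real.exp_pos _).ne h1

/-- Chernoff's bound: `1 ≤ exp (θ (M - S_t))` on the event. Letting `θ` grow at `M = 0` gives
positivity, and letting `t` grow at `θ = 1` gives unboundedness. -/
lemma IsStableSubordinator.measureReal_le [IsProbabilityMeasure P]
    (hS : IsStableSubordinator P β S) (t : ℝ≥0) {θ : ℝ} (hθ : 0 < θ) (M : ℝ) :
    P.real {ω | S t ω ≤ M} ≤ Real.exp (θ * M) * Real.exp (-t * θ ^ β) := by
  rw [← hS.laplace t θ hθ, ← integral_const_mul,
    ← integral_indicator_one (measurableSet_le (hS.measurable t) measurable_const)]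
  refine integral_mono ?_ ((hS.integrable_exp t hθ).const_mul _) fun ω => ?_
  · exact (integrable_const (1 : ℝ)).indicator (measurableSet_le (hS.measurable t) measurable_const)
  · rw [← Real.exp_add]
    by_cases hω : ω ∈ {ω | S t ω ≤ M}
    · rw [indicator_of_mem hω]
      have h1 : S t ω ≤ M := hω
      exact Real.one_le_exp (by nlinarith)
    · rw [indicator_of_notMem hω]
      exact (Real.exp_pos _).le

lemma IsStableSubordinator.ae_pos [IsProbabilityMeasure P] (hβ : 0 < β)
    (hS : IsStableSubordinator P β S) {t : ℝ≥0} (ht : 0 < t) : ∀ᵐ ω ∂P, 0 < S t ω := by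
  have hlim : Tendsto (fun θ : ℝ => Real.exp (-t * θ ^ β)) atTop (𝓝 0) := by
    have h1 : Tendsto (fun θ : ℝ => (t : ℝ) * θ ^ β) atTop atTop :=
      (tendsto_rpow_atTop hβ).const_mul_atTop (NNReal.coe_pos.2 ht)
    refine (Real.tendsto_exp_neg_atTop_nhds_zero.comp h1).congr fun θ => ?_
    simp
  have h0 : P.real {ω | S t ω ≤ 0} ≤ 0 := by
    refine ge_of_tendsto hlim ?_
    filter_upwards [eventually_gt_atTop 0] with θ hθ
    simpa using hS.measureReal_le t hθ 0
  have h1 : P {ω | S t ω ≤ 0} = 0 := by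
    rw [← measureReal_eq_zero_iff]
    exact le_antisymm h0 measureReal_nonneg
  rw [ae_iff]
  simpa using h1

/-- Stationarity makes each increment over a pair of dense times almost surely positive. Countably
many pairs suffice, because two of them fit between any `s < t` and the paths are nondecreasing. -/
lemma IsStableSubordinator.ae_strictMono [IsProbabilityMeasure P] (hβ : 0 < β)
    (hS : IsStableSubordinator P β S) : ∀ᵐ ω ∂P, StrictMono fun t => S t ω := by
  let q := TopologicalSpace.denseSeq ℝ≥0
  have h1 : ∀ᵐ ω ∂P, ∀ m n, q m < q n → S (q m) ω < S (q n) ω := by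
    rw [ae_all_iff]; intro m
    rw [ae_all_iff]; intro n
    by_cases hmn : q m < q n
    · have hpos : 0 < q n - q m := tsub_pos_of_lt hmn
      have h2 := (hS.stationary (q m) (q n - q m)).symm.ae_snd
        (p := fun s => 0 < s) measurableSet_Ioi (hS.ae_pos hβ hpos)
      rw [add_tsub_cancel_of_le hmn.le] at h2
      filter_upwards [h2] with ω hω _
      linarith
    · exact Eventually.of_forall fun ω h => absurd h hmn
  filter_upwards [h1, hS.paths] with ω hω hp s t hst
  obtain ⟨_, ⟨m, rfl⟩, hm⟩ := (TopologicalSpace.denseRange_denseSeq ℝ≥0).exists_between hst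
  obtain ⟨_, ⟨n, rfl⟩, hn⟩ := (TopologicalSpace.denseRange_denseSeq ℝ≥0).exists_between hm.2
  calc S s ω ≤ S (q m) ω := hp.1 hm.1.le
    _ < S (q n) ω := hω m n hn.1
    _ ≤ S t ω := hp.1 hn.2.le

lemma IsStableSubordinator.ae_unbounded [IsProbabilityMeasure P]
    (hS : IsStableSubordinator P β S) : ∀ᵐ ω ∂P, ∀ M, ∃ r, M < S r ω := by
  have h1 : ∀ᵐ ω ∂P, ∀ m : ℕ, ∃ r, (m : ℝ) < S r ω := by
    rw [ae_all_iff]; intro m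
    have hlim : Tendsto (fun n : ℕ => Real.exp m * Real.exp (-(n : ℝ))) atTop (𝓝 0) := by
      simpa using (Real.tendsto_exp_neg_atTop_nhds_zero.comp
        tendsto_natCast_atTop_atTop).const_mul (Real.exp m)
    have h0 : P.real {ω | ∀ r, S r ω ≤ m} ≤ 0 := by
      refine ge_of_tendsto' hlim fun n => ?_
      have h2 := hS.measureReal_le (n : ℝ≥0) one_pos m
      simp only [one_mul, Real.one_rpow, mul_one, NNReal.coe_natCast] at h2
      have hsub : {ω | ∀ r, S r ω ≤ m} ⊆ {ω | S n ω ≤ m} := fun ω hω => hω n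
      exact (measureReal_mono hsub).trans h2
    have h2 : P {ω | ∀ r, S r ω ≤ m} = 0 := by
      rw [← measureReal_eq_zero_iff]
      exact le_antisymm h0 measureReal_nonneg
    rw [ae_iff]
    simpa using h2
  filter_upwards [h1] with ω hω M
  obtain ⟨m, hm⟩ := exists_nat_gt M
  obtain ⟨r, hr⟩ := hω m
  exact ⟨r, hm.trans hr⟩

lemma IsStableSubordinator.exists_strict_version [IsProbabilityMeasure P] (hβ : 0 < β)
    (hS : IsStableSubordinator P β S) :
    ∃ S' : ℝ≥0 → Ω → ℝ, IsStrictSubordinator P β S' ∧ ∀ᵐ ω ∂P, ∀ t, S t ω = S' t ω := by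
  classical
  obtain ⟨G, hGm, hG, hGae⟩ := exists_measurableSet_of_ae
    (hS.start.and ((hS.ae_strictMono hβ).and hS.ae_unbounded))
  -- On the exceptional null set the path is replaced by `t ↦ t`, which starts at `0`, increases
  -- strictly and is unbounded.
  let S' : ℝ≥0 → Ω → ℝ := fun t => G.piecewise (S t) fun _ => t
  have hin : ∀ ω ∈ G, ∀ t, S' t ω = S t ω := fun ω hω t => by simp [S', hω]
  have hout : ∀ ω ∉ G, ∀ t, S' t ω = t := fun ω hω t => by simp [S', hω]
  have hae : ∀ᵐ ω ∂P, ∀ t, S t ω = S' t ω := by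
    filter_upwards [hGae] with ω hω t using (hin ω hω t).symm
  refine ⟨S', ⟨fun t => (hS.measurable t).piecewise hGm measurable_const, fun ω => ?_,
    fun ω => ?_, fun ω M => ?_, fun t θ hθ => ?_⟩, hae⟩
  · by_cases hω : ω ∈ G
    · rw [hin ω hω, (hG ω hω).1]
    · rw [hout ω hω, NNReal.coe_zero]
  · by_cases hω : ω ∈ G
    · simp only [hin ω hω]
      exact (hG ω hω).2.1
    · simp only [hout ω hω]
      exact fun a b hab => NNReal.coe_lt_coe.2 hab
  · by_cases hω : ω ∈ G
    · simp only [hin ω hω]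
      exact (hG ω hω).2.2 M
    · simp only [hout ω hω]
      exact ⟨(|M| + 1).toNNReal, by
        rw [Real.coe_toNNReal _ (by positivity)]
        linarith [le_abs_self M]⟩
  · rw [← hS.laplace t θ hθ]
    refine integral_congr_ae ?_
    filter_upwards [hae] with ω hω
    rw [hω]

end Versions

end FracCauchy

end

/-! ### The theorem for the original processes. -/

open FracCauchy
theorem corollary3p2 {d : ℕ} (hd : 1 ≤ d) (α : ℝ≥0) (hα₀ : 0 < α) (hα₁ : α < 1)
    (β : ℝ) (hβ : β ∈ Ioo (0 : ℝ) 1)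
    (D : Set (Rd d)) (hDo : IsOpen D) (hDc : IsConnected D) (hDb : Bornology.IsBounded D)
    (hDα : HasC1HolderBoundary α D)
    (lam : ℕ → ℝ) (φ : ℕ → Rd d → ℝ) (hφ : IsDirichletEigenbasis D lam φ)
    (f : Rd d → ℝ) (hfdom : ∃ h, HasDirichletLaplacian D f h)
    (hfC1 : IsC1Closure D f) (hfC2 : ContDiffOn ℝ 2 f D)
    (hfexp : ExpansionConverges D φ (Laplacian.laplacian f))
    (u : ℝ → Rd d → ℝ) (hu : IsClassicalSolution D β f u)
    {Ω : Type*} [MeasurableSpace Ω] (P : Measure Ω) [IsProbabilityMeasure P]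
    (x : Rd d) (hx : x ∈ closure D)
    (X : ℝ≥0 → Ω → Rd d) (hX : IsBrownianMotion P x X)
    (S : ℝ≥0 → Ω → ℝ) (hS : IsStableSubordinator P β S)
    (hXS : IndepFun (fun ω t => X t ω) (fun ω t => S t ω) P) :
    (∀ t : ℝ≥0,
      Integrable ({ω | ↑(inverseProcess S t ω) < exitTime D X ω}.indicator
        fun ω => f (X (inverseProcess S t ω) ω)) P ∧
      Integrable ({ω | ↑t < exitTime D (timeChange X (inverseProcess S)) ω}.indicator
        fun ω => f (X (inverseProcess S t ω) ω)) P ∧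
      u t x = ∫ ω, ({ω | ↑(inverseProcess S t ω) < exitTime D X ω}.indicator
        fun ω => f (X (inverseProcess S t ω) ω)) ω ∂P ∧
      u t x = ∫ ω, ({ω | ↑t < exitTime D (timeChange X (inverseProcess S)) ω}.indicator
        fun ω => f (X (inverseProcess S t ω) ω)) ω ∂P) ∧
    (∀ (Y : ℝ≥0 → Ω → Rd d) (e : ℝ≥0 → Ω → ℝ≥0) (ω : Ω),
      Continuous (fun s => Y s ω) → Continuous (fun s => e s ω) → Monotone (fun s => e s ω) →
      e 0 ω = 0 →
      ∀ t : ℝ≥0, ↑t < exitTime D (timeChange Y e) ω ↔ ↑(e t ω) < exitTime D Y ω) := by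
  refine ⟨fun t => ?_, fun Y e ω hY he hm h0 t => lt_exitTime_timeChange_iff hDo hY he hm h0 t⟩
  -- Since `d ≥ 1`, the whole space is unbounded and cannot equal `D`. This keeps the distance to
  -- the complement meaningful in `core`.
  have hne : Dᶜ.Nonempty := by
    rw [nonempty_compl]
    rintro rfl
    have : Nonempty (Fin d) := ⟨⟨0, hd⟩⟩
    exact NormedSpace.unbounded_univ ℝ (Rd d) hDb
  obtain ⟨X', hX', hXX'⟩ := hX.exists_continuous_version
  obtain ⟨S', hS', hSS'⟩ := hS.exists_strict_version hβ.1
  have hXS' : IndepFun (fun ω t => X' t ω) (fun ω t => S' t ω) P := by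
    refine hXS.congr ?_ ?_
    · filter_upwards [hXX'] with ω hω using funext hω
    · filter_upwards [hSS'] with ω hω using funext hω
  obtain ⟨hint, heq⟩ := hu.eq_integral_killedValue hβ hX' hS' hXS' hDo hDb hne hx t
  have hval : ∀ᵐ ω ∂P,
      killedValue X' D f (inverseProcess S' t ω) ω =
        ({ω | ↑(inverseProcess S t ω) < exitTime D X ω}.indicator
          fun ω => f (X (inverseProcess S t ω) ω)) ω ∧
      killedValue X' D f (inverseProcess S' t ω) ω =
        ({ω | ↑t < exitTime D (timeChange X (inverseProcess S)) ω}.indicator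
          fun ω => f (X (inverseProcess S t ω) ω)) ω := by
    -- Almost surely the original and regular paths agree at all times at once, so everything
    -- computed from the whole path, including `E` and the exit times, agrees too.
    filter_upwards [hXX', hSS'] with ω hXω hSω
    have hE : ∀ r, inverseProcess S r ω = inverseProcess S' r ω := fun r => by
      simp only [inverseProcess, hSω]
    have hXc : Continuous fun s => X s ω := by
      simpa only [hXω] using hX'.continuous_path ω
    have hEc : Continuous fun s => inverseProcess S s ω := by
      simpa only [hE] using continuous_inverseProcess (hS'.start_eq ω) (hS'.strictMono ω)
        (hS'.unbounded ω)
    have hEm : Monotone fun s => inverseProcess S s ω := by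
      simpa only [hE] using monotone_inverseProcess (hS'.start_eq ω) (hS'.unbounded ω)
    have hE0 : inverseProcess S 0 ω = 0 := by
      rw [hE, inverseProcess_zero (hS'.start_eq ω) (hS'.strictMono ω)]
    have hiff : ω ∈ stay X' D (inverseProcess S' t ω) ↔
        (inverseProcess S t ω : WithTop ℝ≥0) < exitTime D X ω := by
      rw [lt_exitTime_iff hDo hXc, ← hE, mem_stay, mem_stay]
      simp only [hXω]
    have hiff' := lt_exitTime_timeChange_iff hDo hXc hEc hEm hE0 t
    have hf : f (X' (inverseProcess S' t ω) ω) = f (X (inverseProcess S t ω) ω) := by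
      rw [hXω, hE]
    by_cases h : ω ∈ stay X' D (inverseProcess S' t ω)
    · have h₁ : ω ∈ {ω | ↑(inverseProcess S t ω) < exitTime D X ω} := hiff.1 h
      have h₂ : ω ∈ {ω | ↑t < exitTime D (timeChange X (inverseProcess S)) ω} := hiff'.2 h₁
      rw [killedValue, indicator_of_mem h, hf, indicator_of_mem h₁, indicator_of_mem h₂]
      exact ⟨rfl, rfl⟩
    · have h₁ : ω ∉ {ω | ↑(inverseProcess S t ω) < exitTime D X ω} := fun hc => h (hiff.2 hc)
      have h₂ : ω ∉ {ω | ↑t < exitTime D (timeChange X (inverseProcess S)) ω} :=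
        fun hc => h₁ (hiff'.1 hc)
      rw [killedValue, indicator_of_notMem h, indicator_of_notMem h₁, indicator_of_notMem h₂]
      exact ⟨rfl, rfl⟩
  have hval₁ := hval.mono fun ω h => h.1
  have hval₂ := hval.mono fun ω h => h.2
  exact ⟨hint.congr hval₁, hint.congr hval₂, heq.trans (integral_congr_ae hval₁),
    heq.trans (integral_congr_ae hval₂)⟩
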